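/- Let $r\ge 1$ be an integer and let $K,\lambda>0$. Let $S\in C^2(\mathbb R^{r+1})$ be a local energy of range $r$ with constants $K,\lambda$; that is, $$S(\xi_1,\dots,\xi_{r+1})=\sum_{j=1}^r f_j(\xi_1,\xi_{j+1}),\qquad f_j\in C^2(\mathbb R^2),$$ where for every $1\le j\le r$: (1) $f_j(\nu+1,\mu+1)=f_j(\nu,\mu)$ for all $\nu,\mu\in\mathbb R$; (2) $\|\partial_{i,k}f_j\|_{\sup}\le K/r$ for all $i,k\in\{1,2\}$; (3) $f_j(\nu,\mu)\to\infty$ as $|\nu-\mu|\to\infty$; (4) $\partial_1\partial_2 f_j(\nu,\mu)\le-\lambda$ for all $\nu,\mu\in\mathbb R$. For $x\in\mathbb R^{\mathbb Z}$ put $S_i(x)=S(x_i,\dots,x_{i+r})$. The sequence $x$ is a global minimizer if for all integers $i_0\le i_1$ and all $v\in\mathbb R^{\mathbb Z}$ supported in $[i_0,i_1]$, $$\sum_{i=i_0-r}^{i_1}S_i(x)\le\sum_{i=i_0-r}^{i_1}S_i(x+v).$$ It is Birkhoff if for all $k,l\in\mathbb Z$ the translate $(\tau_{k,l}x)_i=x_{i-k}+l$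 satisfies $\tau_{k,l}x\le x$ or $\tau_{k,l}x\ge x$ pointwise on $\mathbb Z$. Let $$d=6r\left\lceil 24K^2(2r+1)r^2\lambda^{-2}\right\rceil+4r .$$ Let $x$ be a global minimizer, and suppose that there are constants $a>0$ and $0<b<\frac1{2d}$ with $|x_i|\le a\,2^{b|i|}$ for all $i\in\mathbb Z$ (that is, $x$ grows more slowly than exponentially with rate $\frac1{2d}$). Then $x$ is a Birkhoff global minimizer. -/

import Mathlib

open Filter

namespace FrenkelKontorova

/-- Partial derivative of `g : ℝ² → ℝ` in the first (`0`) or second (`1`) variable. -/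
noncomputable def pderiv (i : Fin 2) (g : ℝ × ℝ → ℝ) (p : ℝ × ℝ) : ℝ :=
  if i = 0 then deriv (fun t => g (t, p.2)) p.1 else deriv (fun t => g (p.1, t)) p.2

/-- `S : ℝ^{r+1} → ℝ` is a local energy of range `r`, with uniform constant `K` in the bound on
the second derivatives and constant `lam` in the strong twist condition.
The coordinates `ξ_1, …, ξ_{r+1}` are `ξ 0, …, ξ r`; the `j`-th potential (`1 ≤ j ≤ r`) couples
`ξ_1` with `ξ_{j+1}`. -/
structure IsLocalEnergy (r : ℕ) (K lam : ℝ) (S : (Fin (r + 1) → ℝ) → ℝ) : Prop where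
  one_le_range : 1 ≤ r
  K_pos : 0 < K
  lam_pos : 0 < lam
  contDiff : ContDiff ℝ 2 S
  exists_potentials : ∃ f : Fin r → ℝ × ℝ → ℝ,
    (∀ ξ, S ξ = ∑ j : Fin r, f j (ξ 0, ξ j.succ)) ∧
    ∀ j : Fin r,
      ContDiff ℝ 2 (f j) ∧
      (∀ ν μ : ℝ, f j (ν + 1, μ + 1) = f j (ν, μ)) ∧
      (∀ i k : Fin 2, ∀ p : ℝ × ℝ, |pderiv i (pderiv k (f j)) p| ≤ K / r) ∧
      Tendsto (f j) (comap (fun p : ℝ × ℝ => |p.1 - p.2|) atTop) atTop ∧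
      (∀ p : ℝ × ℝ, pderiv 0 (pderiv 1 (f j)) p ≤ -lam)

/-- `S_j(x) = S(x_j, …, x_{j+r})`. -/
def siteEnergy {r : ℕ} (S : (Fin (r + 1) → ℝ) → ℝ) (j : ℤ) (x : ℤ → ℝ) : ℝ :=
  S fun m => x (j + (m : ℕ))

/-- `W_B(x) = ∑_{i ∈ B} S_i(x)` for the segment `B = [i₀ - r, i₁]`. -/
noncomputable def segmentEnergy {r : ℕ} (S : (Fin (r + 1) → ℝ) → ℝ) (i₀ i₁ : ℤ) (x : ℤ → ℝ) : ℝ :=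
  ∑ i ∈ Finset.Icc (i₀ - r) i₁, siteEnergy S i x

/-- Global minimizers: no variation supported in the interior `[i₀, i₁]` of a segment
`B = [i₀ - r, i₁]` lowers the energy `W_B`. -/
def IsGlobalMinimizer {r : ℕ} (S : (Fin (r + 1) → ℝ) → ℝ) (x : ℤ → ℝ) : Prop :=
  ∀ i₀ i₁ : ℤ, i₀ ≤ i₁ → ∀ v : ℤ → ℝ, Function.support v ⊆ Set.Icc i₀ i₁ →
    segmentEnergy S i₀ i₁ x ≤ segmentEnergy S i₀ i₁ (x + v)

/-- `(τ_{k,l} x)_i = x_{i-k} + l`. -/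
def translate (k l : ℤ) (x : ℤ → ℝ) : ℤ → ℝ :=
  fun i => x (i - k) + l

/-- A Birkhoff sequence is (pointwise) ordered with respect to all its translates. -/
def IsBirkhoff (x : ℤ → ℝ) : Prop :=
  ∀ k l : ℤ, translate k l x ≤ x ∨ x ≤ translate k l x

/-- The constant `d = 6 r ⌈24 K² (2r + 1) r² λ⁻²⌉ + 4 r`. -/
noncomputable def growthConstant (r : ℕ) (K lam : ℝ) : ℕ :=
  6 * r * ⌈24 * K ^ 2 * (2 * r + 1) * r ^ 2 / lam ^ 2⌉₊ + 4 * r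

end FrenkelKontorova

namespace FrenkelKontorova

/-! Let `y` be a translate of the minimizer `x` and `u = x - y`. Exchanging `x` and `y` on a set `A`
changes the sum of their two energies by `c * u i * u k` for each link `(i, k)` cut by `A`, with
`lam ≤ c ≤ K / r` by the twist condition and the derivative bounds. For `A` inside a bounded window
minimality forbids a net gain, so `lam` times the sign-changing cut links is at most `K / r` times
the cut links with equal signs (`cutSum_negLink_le`). If such exchanges can be made at arbitrarily
small cost, the limiting hybrid sequence is stationary; a Harnack inequality then makes `{u > 0}`
empty or everything, so `x` and `y` are ordered (`eq_empty_or_univ_of_cutSum_small`).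

Take `A = {u > 0} ∩ [a, b]` with `u a ≤ 0` and `u b ≤ 0`. Equal-sign links are cut only at the two
ends, where stationarity bounds them by nearby sign changes. Hence, if nonpositive sites occur with
bounded gaps on both sides, the total weight of sign changes in `[-n, n]` is zero or grows
exponentially in `n`. This weight is quadratic in `u`, so slow growth of `x` makes it vanish, and
exchanges become free (`le_or_le_of_frequently_nonpos`).

Otherwise, applied to `u` and `-u`, blocks of `r` consecutive sites of strict sign recur arbitrarily
far out. No sign change survives between two blocks of the same sign, so `u` has one weak sign near
`+∞` and the opposite one near `-∞` (`ordered_or_crossing`).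

To exclude this single crossing, take a periodic minimizer `w` with `w (i + k) = w i + l`. Then `u`
is the `k`-step increment of `x - w`. If `u` fades at one end, exchange is again almost free. If
not, `x - w` tends to the same infinity at both ends, so some integer translate of `w` exceeds `x`
(or the reverse) exactly on a bounded nonempty set, which minimality forbids
(`ordered_of_crossing`). -/

/-! ### Calculus of pair potentials: mean values and the mixed derivative. -/

lemma hasDerivAt_pderiv_zero {g : ℝ × ℝ → ℝ} (hg : Differentiable ℝ g) (a b : ℝ) :
    HasDerivAt (fun t => g (t, b)) (pderiv 0 g (a, b)) a := by
  have h : DifferentiableAt ℝ (fun t => g (t, b)) a :=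
    (hg (a, b)).comp a (by fun_prop : DifferentiableAt ℝ (fun t : ℝ => (t, b)) a)
  simpa [pderiv] using h.hasDerivAt

lemma hasDerivAt_pderiv_one {g : ℝ × ℝ → ℝ} (hg : Differentiable ℝ g) (a b : ℝ) :
    HasDerivAt (fun t => g (a, t)) (pderiv 1 g (a, b)) b := by
  have h : DifferentiableAt ℝ (fun t => g (a, t)) b :=
    (hg (a, b)).comp b (by fun_prop : DifferentiableAt ℝ (fun t : ℝ => (a, t)) b)
  simpa [pderiv] using h.hasDerivAt

lemma pderiv_zero_eq_fderiv {g : ℝ × ℝ → ℝ} (hg : Differentiable ℝ g) :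
    pderiv 0 g = fun p => fderiv ℝ g p (1, 0) := by
  funext p
  have h := (hg p).hasFDerivAt.comp_hasDerivAt p.1
    ((hasDerivAt_id p.1).prodMk (hasDerivAt_const p.1 p.2))
  exact (hasDerivAt_pderiv_zero hg p.1 p.2).unique h

lemma pderiv_one_eq_fderiv {g : ℝ × ℝ → ℝ} (hg : Differentiable ℝ g) :
    pderiv 1 g = fun p => fderiv ℝ g p (0, 1) := by
  funext p
  have h := (hg p).hasFDerivAt.comp_hasDerivAt p.2
    ((hasDerivAt_const p.2 p.1).prodMk (hasDerivAt_id p.2))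
  exact (hasDerivAt_pderiv_one hg p.1 p.2).unique h

lemma contDiff_pderiv {g : ℝ × ℝ → ℝ} (hg : ContDiff ℝ 2 g) (i : Fin 2) :
    ContDiff ℝ 1 (pderiv i g) := by
  have hd : Differentiable ℝ g := hg.differentiable (by norm_num)
  have h1 : ContDiff ℝ 1 (fderiv ℝ g) := hg.fderiv_right (by norm_num)
  fin_cases i
  · simp only [Fin.zero_eta, pderiv_zero_eq_fderiv hd]; exact h1.clm_apply contDiff_const
  · simp only [Fin.mk_one, pderiv_one_eq_fderiv hd]; exact h1.clm_apply contDiff_const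

lemma pderiv_comm {g : ℝ × ℝ → ℝ} (hg : ContDiff ℝ 2 g) (p : ℝ × ℝ) :
    pderiv 1 (pderiv 0 g) p = pderiv 0 (pderiv 1 g) p := by
  have hd : Differentiable ℝ g := hg.differentiable (by norm_num)
  have hd2 : Differentiable ℝ (fderiv ℝ g) :=
    (hg.fderiv_right (m := 1) (by norm_num)).differentiable (by norm_num)
  have e : ∀ v w : ℝ × ℝ, fderiv ℝ (fun p => fderiv ℝ g p v) p w
      = fderiv ℝ (fderiv ℝ g) p w v := by
    intro v w
    rw [fderiv_clm_apply (hd2 p) (differentiableAt_const v)]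
    simp
  have hs := (hg.contDiffAt (x := p)).isSymmSndFDerivAt (by simp)
  rw [pderiv_one_eq_fderiv ((contDiff_pderiv hg 0).differentiable (by norm_num)),
    pderiv_zero_eq_fderiv ((contDiff_pderiv hg 1).differentiable (by norm_num)),
    pderiv_zero_eq_fderiv hd, pderiv_one_eq_fderiv hd]
  simp only [e]
  exact hs _ _

lemma exists_sub_eq_pderiv_zero {g : ℝ × ℝ → ℝ} (hg : Differentiable ℝ g) (a a' b : ℝ) :
    ∃ ξ, g (a, b) - g (a', b) = pderiv 0 g (ξ, b) * (a - a') := by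
  rcases lt_trichotomy a a' with h | h | h
  · obtain ⟨c, -, hc⟩ := exists_hasDerivAt_eq_slope (fun t => g (t, b)) _ h
      (HasDerivAt.continuousOn fun t _ => hasDerivAt_pderiv_zero hg t b)
      (fun t _ => hasDerivAt_pderiv_zero hg t b)
    refine ⟨c, ?_⟩
    rw [hc]
    have : a' - a ≠ 0 := by linarith
    field_simp; ring
  · exact ⟨a, by simp [h]⟩
  · obtain ⟨c, -, hc⟩ := exists_hasDerivAt_eq_slope (fun t => g (t, b)) _ h
      (HasDerivAt.continuousOn fun t _ => hasDerivAt_pderiv_zero hg t b)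
      (fun t _ => hasDerivAt_pderiv_zero hg t b)
    refine ⟨c, ?_⟩
    rw [hc]
    have : a - a' ≠ 0 := by linarith
    field_simp

lemma exists_sub_eq_pderiv_one {g : ℝ × ℝ → ℝ} (hg : Differentiable ℝ g) (a b b' : ℝ) :
    ∃ ξ, g (a, b) - g (a, b') = pderiv 1 g (a, ξ) * (b - b') := by
  rcases lt_trichotomy b b' with h | h | h
  · obtain ⟨c, -, hc⟩ := exists_hasDerivAt_eq_slope (fun t => g (a, t)) _ h
      (HasDerivAt.continuousOn fun t _ => hasDerivAt_pderiv_one hg a t)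
      (fun t _ => hasDerivAt_pderiv_one hg a t)
    refine ⟨c, ?_⟩
    rw [hc]
    have : b' - b ≠ 0 := by linarith
    field_simp; ring
  · exact ⟨b, by simp [h]⟩
  · obtain ⟨c, -, hc⟩ := exists_hasDerivAt_eq_slope (fun t => g (a, t)) _ h
      (HasDerivAt.continuousOn fun t _ => hasDerivAt_pderiv_one hg a t)
      (fun t _ => hasDerivAt_pderiv_one hg a t)
    refine ⟨c, ?_⟩
    rw [hc]
    have : b - b' ≠ 0 := by linarith
    field_simp

/-- A pair potential whose second derivatives are bounded by `κ` and which satisfies the twist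
condition with constant `lam`. -/
structure IsTwistPair (κ lam : ℝ) (g : ℝ × ℝ → ℝ) : Prop where
  contDiff : ContDiff ℝ 2 g
  bound : ∀ i k : Fin 2, ∀ p : ℝ × ℝ, |pderiv i (pderiv k g) p| ≤ κ
  twist : ∀ p : ℝ × ℝ, pderiv 0 (pderiv 1 g) p ≤ -lam

namespace IsTwistPair

variable {κ lam : ℝ} {g : ℝ × ℝ → ℝ}

lemma differentiable (hg : IsTwistPair κ lam g) : Differentiable ℝ g :=
  hg.contDiff.differentiable (by norm_num)

lemma differentiable_pderiv (hg : IsTwistPair κ lam g) (i : Fin 2) :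
    Differentiable ℝ (pderiv i g) :=
  (contDiff_pderiv hg.contDiff i).differentiable (by norm_num)

lemma neg_mixed_mem (hg : IsTwistPair κ lam g) (p : ℝ × ℝ) :
    lam ≤ -pderiv 0 (pderiv 1 g) p ∧ -pderiv 0 (pderiv 1 g) p ≤ κ :=
  ⟨by linarith [hg.twist p], by linarith [(abs_le.1 (hg.bound 0 1 p)).1]⟩

/-- The mean value theorem in each variable in turn makes `c` a value of `-∂₁∂₂g`. This is the only
input of the exchange arguments: the energy gained or lost by swapping one end of a link has the
sign of the product of the differences. -/
lemma exists_cross_diff (hg : IsTwistPair κ lam g) (a a' b b' : ℝ) :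
    ∃ c, lam ≤ c ∧ c ≤ κ ∧
      g (a', b) + g (a, b') - g (a, b) - g (a', b') = c * ((a - a') * (b - b')) := by
  -- The auxiliary function ignores its first variable; the base value `0` is a dummy.
  obtain ⟨ξ, hξ⟩ := exists_sub_eq_pderiv_one (g := fun p => g (a, p.2) - g (a', p.2))
    (((hg.differentiable).comp (by fun_prop)).sub ((hg.differentiable).comp (by fun_prop))) 0 b b'
  have e : pderiv 1 (fun p : ℝ × ℝ => g (a, p.2) - g (a', p.2)) (0, ξ)
      = pderiv 1 g (a, ξ) - pderiv 1 g (a', ξ) := by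
    have := ((hasDerivAt_pderiv_one hg.differentiable a ξ).sub
      (hasDerivAt_pderiv_one hg.differentiable a' ξ)).deriv
    simpa [pderiv, Pi.sub_def] using this
  obtain ⟨η, hη⟩ := exists_sub_eq_pderiv_zero (hg.differentiable_pderiv 1) a a' ξ
  obtain ⟨h1, h2⟩ := hg.neg_mixed_mem (η, ξ)
  refine ⟨_, h1, h2, ?_⟩
  rw [e, hη] at hξ
  simp only at hξ
  linear_combination -hξ

lemma exists_pderiv_zero_diff (hg : IsTwistPair κ lam g) (a a' b b' : ℝ) :
    ∃ α c, |α| ≤ κ ∧ lam ≤ c ∧ c ≤ κ ∧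
      pderiv 0 g (a, b) - pderiv 0 g (a', b') = α * (a - a') - c * (b - b') := by
  obtain ⟨η, hη⟩ := exists_sub_eq_pderiv_zero (hg.differentiable_pderiv 0) a a' b
  obtain ⟨ξ, hξ⟩ := exists_sub_eq_pderiv_one (hg.differentiable_pderiv 0) a' b b'
  rw [pderiv_comm hg.contDiff] at hξ
  obtain ⟨h1, h2⟩ := hg.neg_mixed_mem (a', ξ)
  exact ⟨_, _, hg.bound 0 0 (η, b), h1, h2, by linear_combination hη + hξ⟩

lemma exists_pderiv_one_diff (hg : IsTwistPair κ lam g) (a a' b b' : ℝ) :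
    ∃ α c, |α| ≤ κ ∧ lam ≤ c ∧ c ≤ κ ∧
      pderiv 1 g (a, b) - pderiv 1 g (a', b') = α * (b - b') - c * (a - a') := by
  obtain ⟨η, hη⟩ := exists_sub_eq_pderiv_one (hg.differentiable_pderiv 1) a b b'
  obtain ⟨ξ, hξ⟩ := exists_sub_eq_pderiv_zero (hg.differentiable_pderiv 1) a a' b'
  obtain ⟨h1, h2⟩ := hg.neg_mixed_mem (ξ, b')
  exact ⟨_, _, hg.bound 1 1 (a, η), h1, h2, by linear_combination hη + hξ⟩

end IsTwistPair

/-! ### Energies and minimality in terms of the potentials. -/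

/-- The displacement `j + 1` between the sites coupled by the `j`-th potential. -/
def disp {r : ℕ} (j : Fin r) : ℤ := ((j : ℕ) : ℤ) + 1

lemma one_le_disp {r : ℕ} (j : Fin r) : 1 ≤ disp j := by unfold disp; omega

lemma disp_le {r : ℕ} (j : Fin r) : disp j ≤ r := by
  have := j.isLt
  unfold disp; omega

lemma exists_disp_eq {r : ℕ} {m : ℤ} (h1 : 1 ≤ m) (h2 : m ≤ r) : ∃ j : Fin r, disp j = m :=
  ⟨⟨(m - 1).toNat, by omega⟩, by unfold disp; simp only; omega⟩

/-- The conditions on the potentials of a local energy. -/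
structure IsPotentialFamily {r : ℕ} (K lam : ℝ) (f : Fin r → ℝ × ℝ → ℝ) : Prop where
  one_le_range : 1 ≤ r
  K_pos : 0 < K
  lam_pos : 0 < lam
  pair : ∀ j, IsTwistPair (K / r) lam (f j)
  periodic : ∀ j, ∀ ν μ : ℝ, f j (ν + 1, μ + 1) = f j (ν, μ)
  coercive : ∀ j, Tendsto (f j) (comap (fun p : ℝ × ℝ => |p.1 - p.2|) atTop) atTop

variable {r : ℕ}

/-- The energy of the links starting in a finite set of sites. -/
noncomputable def linkEnergy (f : Fin r → ℝ × ℝ → ℝ) (B : Finset ℤ) (x : ℤ → ℝ) : ℝ :=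
  ∑ i ∈ B, ∑ j, f j (x i, x (i + disp j))

/-- Minimality with respect to variations of compact support, in terms of the potentials. -/
def IsMinimizing (f : Fin r → ℝ × ℝ → ℝ) (x : ℤ → ℝ) : Prop :=
  ∀ i₀ i₁ : ℤ, i₀ ≤ i₁ → ∀ z : ℤ → ℝ, (∀ i, i ∉ Set.Icc i₀ i₁ → z i = x i) →
    linkEnergy f (Finset.Icc (i₀ - r) i₁) x ≤ linkEnergy f (Finset.Icc (i₀ - r) i₁) z

lemma segmentEnergy_eq_linkEnergy {S : (Fin (r + 1) → ℝ) → ℝ} {f : Fin r → ℝ × ℝ → ℝ}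
    (hf : ∀ ξ, S ξ = ∑ j : Fin r, f j (ξ 0, ξ j.succ)) (i₀ i₁ : ℤ) (x : ℤ → ℝ) :
    segmentEnergy S i₀ i₁ x = linkEnergy f (Finset.Icc (i₀ - r) i₁) x := by
  simp [segmentEnergy, linkEnergy, siteEnergy, hf, disp]

lemma isGlobalMinimizer_iff_isMinimizing {S : (Fin (r + 1) → ℝ) → ℝ} {f : Fin r → ℝ × ℝ → ℝ}
    (hf : ∀ ξ, S ξ = ∑ j : Fin r, f j (ξ 0, ξ j.succ)) (x : ℤ → ℝ) :
    IsGlobalMinimizer S x ↔ IsMinimizing f x := by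
  simp only [IsGlobalMinimizer, IsMinimizing, segmentEnergy_eq_linkEnergy hf]
  constructor
  · intro h i₀ i₁ hi z hz
    have := h i₀ i₁ hi (z - x) (by
      intro i hi'
      by_contra hc
      exact hi' (by simp [hz i hc]))
    simpa using this
  · intro h i₀ i₁ hi v hv
    refine h i₀ i₁ hi _ fun i hi' => ?_
    have : v i = 0 := by
      by_contra hc
      exact hi' (hv hc)
    simp [this]

/-- The change of energy when the site `i` is displaced by `t`. -/
noncomputable def siteVariation (f : Fin r → ℝ × ℝ → ℝ) (x : ℤ → ℝ) (i : ℤ) (t : ℝ) : ℝ :=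
  ∑ j, (f j (x i + t, x (i + disp j)) - f j (x i, x (i + disp j)) +
    (f j (x (i - disp j), x i + t) - f j (x (i - disp j), x i)))

/-- The derivative of the energy with respect to the site `i`. -/
noncomputable def energyGradient (f : Fin r → ℝ × ℝ → ℝ) (x : ℤ → ℝ) (i : ℤ) : ℝ :=
  ∑ j, (pderiv 0 (f j) (x i, x (i + disp j)) + pderiv 1 (f j) (x (i - disp j), x i))

/-- Only the links starting or ending at `i` change, and the margin `r` on the left of the window
ensures that all of them are counted. -/
lemma linkEnergy_update (f : Fin r → ℝ × ℝ → ℝ) {i₀ i₁ i : ℤ} (h0 : i₀ ≤ i) (h1 : i ≤ i₁)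
    (x : ℤ → ℝ) (t : ℝ) :
    linkEnergy f (Finset.Icc (i₀ - r) i₁) (Function.update x i (x i + t)) =
      linkEnergy f (Finset.Icc (i₀ - r) i₁) x + siteVariation f x i t := by
  rw [← sub_eq_iff_eq_add']
  unfold linkEnergy siteVariation
  rw [← Finset.sum_sub_distrib, Finset.sum_congr rfl fun m _ => (Finset.sum_sub_distrib _ _).symm,
    Finset.sum_comm]
  refine Finset.sum_congr rfl fun j _ => ?_
  have hj := one_le_disp j
  have hj' := disp_le j
  have hne : i ≠ i - disp j := by omega
  rw [← Finset.sum_subset (s₁ := {i, i - disp j}), Finset.sum_pair hne]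
  · have e1 : i + disp j ≠ i := by omega
    have e2 : i - disp j ≠ i := by omega
    simp [Function.update_of_ne e1, Function.update_of_ne e2]
  · intro m hm
    simp only [Finset.mem_insert, Finset.mem_singleton] at hm
    simp only [Finset.mem_Icc]
    omega
  · intro m _ hm
    simp only [Finset.mem_insert, Finset.mem_singleton, not_or] at hm
    rw [Function.update_of_ne hm.1, Function.update_of_ne (by omega), sub_self]

/-! ### Stationarity and Harnack inequalities. -/

namespace IsPotentialFamily

variable {K lam : ℝ} {f : Fin r → ℝ × ℝ → ℝ}

lemma range_pos (hf : IsPotentialFamily K lam f) : (0 : ℝ) < r := by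
  exact_mod_cast hf.one_le_range

lemma hasDerivAt_siteVariation (hf : IsPotentialFamily K lam f) (x : ℤ → ℝ) (i : ℤ) :
    HasDerivAt (siteVariation f x i) (energyGradient f x i) 0 := by
  unfold siteVariation energyGradient
  refine HasDerivAt.fun_sum fun j _ => ?_
  have h0 := hasDerivAt_pderiv_zero (hf.pair j).differentiable (x i) (x (i + disp j))
  have h1 := hasDerivAt_pderiv_one (hf.pair j).differentiable (x (i - disp j)) (x i)
  have a0 := HasDerivAt.comp_const_add (x i) 0 (by simpa using h0)
  have a1 := HasDerivAt.comp_const_add (x i) 0 (by simpa using h1)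
  exact (a0.sub_const _).add (a1.sub_const _)

lemma energyGradient_eq_zero_of_nonneg (hf : IsPotentialFamily K lam f) {x : ℤ → ℝ} {i : ℤ}
    (h : ∀ t, 0 ≤ siteVariation f x i t) : energyGradient f x i = 0 := by
  refine IsLocalMin.hasDerivAt_eq_zero (f := siteVariation f x i) (a := 0) ?_
    (hf.hasDerivAt_siteVariation x i)
  refine Eventually.of_forall fun t => ?_
  have : siteVariation f x i 0 = 0 := by simp [siteVariation]
  simpa [this] using h t

lemma energyGradient_eq_zero (hf : IsPotentialFamily K lam f) {x : ℤ → ℝ}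
    (hx : IsMinimizing f x) (i : ℤ) : energyGradient f x i = 0 := by
  refine hf.energyGradient_eq_zero_of_nonneg fun t => ?_
  have h := hx i i le_rfl (Function.update x i (x i + t)) (fun m hm => by
    rw [Function.update_of_ne]
    rintro rfl
    simp at hm)
  rw [linkEnergy_update f le_rfl le_rfl] at h
  linarith

/-- A Harnack inequality for the difference of two stationary sequences. -/
lemma sum_posPart_le (hf : IsPotentialFamily K lam f) {x y : ℤ → ℝ} {i : ℤ}
    (hx : energyGradient f x i = 0) (hy : energyGradient f y i = 0) {u : ℤ → ℝ}
    (hu : ∀ m, u m = x m - y m) :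
    lam * ∑ j : Fin r, (max (u (i + disp j)) 0 + max (u (i - disp j)) 0) ≤
      K / r * ∑ j : Fin r, (max (-u (i + disp j)) 0 + max (-u (i - disp j)) 0)
        + 2 * K * |u i| := by
  have hr := hf.range_pos
  -- The off-diagonal coefficients lie in `[lam, K / r]`, so positive values are weighted by at
  -- least `lam` and negative ones by at most `K / r`.
  have key : ∀ c v : ℝ, lam ≤ c → c ≤ K / r →
      lam * max v 0 - K / r * max (-v) 0 ≤ c * v := by
    intro c v h1 h2
    have hl := hf.lam_pos
    rcases le_total v 0 with hv | hv
    · rw [max_eq_right hv, max_eq_left (by linarith)]; nlinarith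
    · rw [max_eq_left hv, max_eq_right (by linarith)]; nlinarith
  have key2 : ∀ α v : ℝ, |α| ≤ K / r → α * v ≤ K / r * |v| := by
    intro α v h
    exact (le_abs_self _).trans (by rw [abs_mul]; gcongr)
  have h : ∀ j : Fin r,
      (pderiv 0 (f j) (x i, x (i + disp j)) + pderiv 1 (f j) (x (i - disp j), x i)) -
      (pderiv 0 (f j) (y i, y (i + disp j)) + pderiv 1 (f j) (y (i - disp j), y i)) ≤
      2 * (K / r * |u i|) - lam * (max (u (i + disp j)) 0 + max (u (i - disp j)) 0)
       + K / r * (max (-u (i + disp j)) 0 + max (-u (i - disp j)) 0) := by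
    intro j
    obtain ⟨α, c, h1, h2, h3, h4⟩ :=
      (hf.pair j).exists_pderiv_zero_diff (x i) (y i) (x (i + disp j)) (y (i + disp j))
    obtain ⟨β, d, g1, g2, g3, g4⟩ :=
      (hf.pair j).exists_pderiv_one_diff (x (i - disp j)) (y (i - disp j)) (x i) (y i)
    rw [← hu, ← hu] at h4 g4
    have := key c (u (i + disp j)) h2 h3
    have := key d (u (i - disp j)) g2 g3
    have := key2 α (u i) h1
    have := key2 β (u i) g1
    linarith
  have hs := Finset.sum_le_sum fun j (_ : j ∈ Finset.univ) => h j
  rw [Finset.sum_sub_distrib] at hs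
  change energyGradient f x i - energyGradient f y i ≤ _ at hs
  rw [hx, hy, Finset.sum_add_distrib, Finset.sum_sub_distrib, ← Finset.mul_sum (a := lam),
    ← Finset.mul_sum (a := K / r), Finset.sum_const, Finset.card_univ, Fintype.card_fin,
    nsmul_eq_mul] at hs
  have e : (r : ℝ) * (2 * (K / r * |u i|)) = 2 * K * |u i| := by field_simp
  linarith

/-- A negative value of the neighbouring displacements dominates each positive one. -/
lemma exists_neg_ge (hf : IsPotentialFamily K lam f) {x y : ℤ → ℝ} {q : ℤ}
    (hx : energyGradient f x q = 0) (hy : energyGradient f y q = 0) {u : ℤ → ℝ}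
    (hu : ∀ m, u m = x m - y m) (hq : u q ≤ 0) {i : ℤ} (hi : 0 < u i)
    (h1 : q - r ≤ i) (h2 : i ≤ q + r) :
    ∃ k, q - r ≤ k ∧ k ≤ q + r ∧ lam * u i ≤ 4 * K * (-u k) := by
  have hr := hf.range_pos
  have hK := hf.K_pos
  have hl := hf.lam_pos
  -- If every `-u k` in the window were below `lam * u i / (4 * K)`, the `2 * r` negative parts
  -- would contribute at most `lam * u i / 2`, and the diagonal term less than `lam * u i / 2`,
  -- contradicting the Harnack inequality.
  by_contra! hc
  have hm : 0 < lam * u i := by positivity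
  have hneg : ∀ k, q - r ≤ k → k ≤ q + r → max (-u k) 0 ≤ lam * u i / (4 * K) := by
    intro k h1 h2
    refine max_le ?_ (by positivity)
    rw [le_div_iff₀ (by positivity)]
    linarith [hc k h1 h2]
  have hH := hf.sum_posPart_le hx hy hu
  have hA : lam * u i ≤
      lam * ∑ j : Fin r, (max (u (q + disp j)) 0 + max (u (q - disp j)) 0) := by
    refine mul_le_mul_of_nonneg_left ?_ hl.le
    have hiq : i ≠ q := by rintro rfl; linarith
    have hex : ∃ j : Fin r, i = q + disp j ∨ i = q - disp j := by
      rcases lt_or_gt_of_ne hiq with h | h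
      · obtain ⟨j, hj⟩ := exists_disp_eq (r := r) (m := q - i) (by omega) (by omega)
        exact ⟨j, by omega⟩
      · obtain ⟨j, hj⟩ := exists_disp_eq (r := r) (m := i - q) (by omega) (by omega)
        exact ⟨j, by omega⟩
    obtain ⟨j, hj⟩ := hex
    refine le_trans ?_ (Finset.single_le_sum (f := fun j : Fin r =>
      (max (u (q + disp j)) 0 + max (u (q - disp j)) 0)) (fun j _ => by positivity)
      (Finset.mem_univ j))
    have p1 := le_max_right (u (q + disp j)) 0
    have p2 := le_max_right (u (q - disp j)) 0
    have p3 := le_max_left (u (q + disp j)) 0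
    have p4 := le_max_left (u (q - disp j)) 0
    rcases hj with hj | hj <;> rw [hj] <;> linarith
  have hB : K / r * ∑ j : Fin r, (max (-u (q + disp j)) 0 + max (-u (q - disp j)) 0)
      ≤ lam * u i / 2 := by
    calc K / r * ∑ j : Fin r, (max (-u (q + disp j)) 0 + max (-u (q - disp j)) 0)
        ≤ K / r * ∑ j : Fin r, (lam * u i / (4 * K) + lam * u i / (4 * K)) := by
          gcongr with j
          · exact hneg _ (by linarith [one_le_disp j]) (by linarith [disp_le j])
          · exact hneg _ (by linarith [disp_le j]) (by linarith [one_le_disp j])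
      _ = lam * u i / 2 := by
          rw [Finset.sum_const, Finset.card_univ, Fintype.card_fin, nsmul_eq_mul]
          field_simp; ring
  have hC := hc q (by omega) (by omega)
  rw [abs_of_nonpos hq] at hH
  linarith

/-- Harnack inequality for nonnegative differences. -/
lemma le_of_nonneg (hf : IsPotentialFamily K lam f) {x y : ℤ → ℝ} {i : ℤ}
    (hx : energyGradient f x i = 0) (hy : energyGradient f y i = 0) {u : ℤ → ℝ}
    (hu : ∀ m, u m = x m - y m) (hn : ∀ m, i - r ≤ m → m ≤ i + r → 0 ≤ u m) :
    lam * u (i + 1) ≤ 2 * K * u i ∧ lam * u (i - 1) ≤ 2 * K * u i := by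
  have hH := hf.sum_posPart_le hx hy hu
  have hl := hf.lam_pos
  rw [Finset.sum_eq_zero (f := fun j : Fin r =>
    (max (-u (i + disp j)) 0 + max (-u (i - disp j)) 0)), mul_zero, zero_add,
    abs_of_nonneg (hn i (by omega) (by omega))] at hH
  · obtain ⟨j, hj⟩ := exists_disp_eq (r := r) (m := 1) le_rfl (by exact_mod_cast hf.one_le_range)
    have hA := Finset.single_le_sum (f := fun j : Fin r =>
      (max (u (i + disp j)) 0 + max (u (i - disp j)) 0)) (fun j _ => by positivity)
      (Finset.mem_univ j)
    simp only [hj] at hA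
    have p1 := le_max_right (u (i + 1)) 0
    have p2 := le_max_right (u (i - 1)) 0
    have p3 := le_max_left (u (i + 1)) 0
    have p4 := le_max_left (u (i - 1)) 0
    constructor <;> nlinarith
  · intro j _
    have h1 := one_le_disp j
    have h2 := disp_le j
    rw [max_eq_right (by linarith [hn (i + disp j) (by omega) (by omega)]),
      max_eq_right (by linarith [hn (i - disp j) (by omega) (by omega)]), add_zero]

end IsPotentialFamily

/-! ### Exchanging two minimizers on a set of sites. -/

open Classical in
/-- The sequence that equals `y` on `A` and `x` off `A`. -/
noncomputable def swapOn (A : Set ℤ) (x y : ℤ → ℝ) : ℤ → ℝ :=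
  fun i => if i ∈ A then y i else x i

lemma swapOn_of_mem {A : Set ℤ} {i : ℤ} (h : i ∈ A) (x y : ℤ → ℝ) : swapOn A x y i = y i :=
  if_pos h

lemma swapOn_of_notMem {A : Set ℤ} {i : ℤ} (h : i ∉ A) (x y : ℤ → ℝ) : swapOn A x y i = x i :=
  if_neg h

open Classical in
/-- The sum of `w i k` over the links `(i, k)`, `i ∈ B`, between `A` and its complement. -/
noncomputable def cutSum (r : ℕ) (A : Set ℤ) (B : Finset ℤ) (w : ℤ → ℤ → ℝ) : ℝ :=
  ∑ i ∈ B, ∑ j : Fin r, if (i ∈ A ↔ i + disp j ∈ A) then 0 else w i (i + disp j)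

/-- The positive part of `u i * u k`. -/
noncomputable def posLink (u : ℤ → ℝ) (i k : ℤ) : ℝ := max (u i * u k) 0

/-- The negative part of `u i * u k`. -/
noncomputable def negLink (u : ℤ → ℝ) (i k : ℤ) : ℝ := max (-(u i * u k)) 0

lemma negLink_nonneg (u : ℤ → ℝ) (i k : ℤ) : 0 ≤ negLink u i k := le_max_right _ _

namespace IsPotentialFamily

variable {K lam : ℝ} {f : Fin r → ℝ × ℝ → ℝ}

/-- Uncut links are merely redistributed between the two hybrids; a cut link contributes its cross
difference `c * (u i * u k)`. -/
lemma linkEnergy_swapOn_add_le (hf : IsPotentialFamily K lam f) {x y u : ℤ → ℝ}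
    (hu : ∀ m, u m = x m - y m) (A : Set ℤ) (B : Finset ℤ) :
    linkEnergy f B (swapOn A x y) + linkEnergy f B (swapOn A y x) ≤
      linkEnergy f B x + linkEnergy f B y +
        (K / r * cutSum r A B (posLink u) - lam * cutSum r A B (negLink u)) := by
  unfold linkEnergy cutSum
  simp only [Finset.mul_sum, ← Finset.sum_add_distrib, ← Finset.sum_sub_distrib]
  refine Finset.sum_le_sum fun i _ => Finset.sum_le_sum fun j _ => ?_
  obtain ⟨c, h1, h2, h3⟩ :=
    (hf.pair j).exists_cross_diff (x i) (y i) (x (i + disp j)) (y (i + disp j))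
  rw [← hu, ← hu] at h3
  have key : c * (u i * u (i + disp j)) ≤
      K / r * posLink u i (i + disp j) - lam * negLink u i (i + disp j) := by
    have hl := hf.lam_pos
    unfold posLink negLink
    set v := u i * u (i + disp j)
    rcases le_total v 0 with hv | hv
    · rw [max_eq_right hv, max_eq_left (by linarith)]; nlinarith
    · rw [max_eq_left hv, max_eq_right (by linarith)]; nlinarith
  by_cases ha : i ∈ A <;> by_cases hb : i + disp j ∈ A <;>
    simp only [swapOn, ha, hb, if_true, if_false, iff_true, iff_false, not_true] <;> linarith

lemma linkEnergy_swapOn_le (hf : IsPotentialFamily K lam f) {x y u : ℤ → ℝ}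
    (hy : IsMinimizing f y) (hu : ∀ m, u m = x m - y m)
    {A : Set ℤ} {a b : ℤ} (hab : a ≤ b) (hA : A ⊆ Set.Icc a b) :
    linkEnergy f (Finset.Icc (a - r) b) (swapOn A x y) ≤
      linkEnergy f (Finset.Icc (a - r) b) x +
        (K / r * cutSum r A (Finset.Icc (a - r) b) (posLink u)
          - lam * cutSum r A (Finset.Icc (a - r) b) (negLink u)) := by
  have h := hf.linkEnergy_swapOn_add_le hu A (Finset.Icc (a - r) b)
  have h2 := hy a b hab (swapOn A y x) (fun i hi => swapOn_of_notMem (fun h => hi (hA h)) _ _)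
  linarith

lemma cutSum_negLink_le (hf : IsPotentialFamily K lam f) {x y u : ℤ → ℝ}
    (hx : IsMinimizing f x) (hy : IsMinimizing f y) (hu : ∀ m, u m = x m - y m)
    {A : Set ℤ} {a b : ℤ} (hab : a ≤ b) (hA : A ⊆ Set.Icc a b) :
    lam * cutSum r A (Finset.Icc (a - r) b) (negLink u) ≤
      K / r * cutSum r A (Finset.Icc (a - r) b) (posLink u) := by
  have h := hf.linkEnergy_swapOn_le hy hu hab hA
  have h2 := hx a b hab (swapOn A x y) (fun i hi => swapOn_of_notMem (fun h => hi (hA h)) _ _)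
  linarith

/-- A finite approximation `A` of `A₀` gives a compactly supported variation of `x` of almost
minimal energy. Moving the site `i` as well cannot go below the energy of `x`, so the variation at
`i` is at least `-ε` for every `ε`. -/
lemma energyGradient_swapOn_eq_zero (hf : IsPotentialFamily K lam f) {x y u : ℤ → ℝ}
    (hx : IsMinimizing f x) (hy : IsMinimizing f y) (hu : ∀ m, u m = x m - y m) {A₀ : Set ℤ}
    (hA₀ : ∀ n : ℤ, 0 ≤ n → ∀ ε > 0, ∃ A : Set ℤ, ∃ a b : ℤ, a ≤ -n ∧ n ≤ b ∧ A ⊆ Set.Icc a b ∧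
      (∀ m, -n ≤ m → m ≤ n → (m ∈ A ↔ m ∈ A₀)) ∧
      cutSum r A (Finset.Icc (a - r) b) (posLink u) ≤ ε) (i : ℤ) :
    energyGradient f (swapOn A₀ x y) i = 0 := by
  refine hf.energyGradient_eq_zero_of_nonneg fun t => ?_
  have hr := hf.range_pos
  have hκ : 0 < K / r := div_pos hf.K_pos hr
  refine le_of_forall_pos_le_add fun ε hε => ?_
  obtain ⟨A, a, b, ha, hb, hA, hAA, hc⟩ := hA₀ (|i| + r) (by positivity) (ε / (K / r))
    (by positivity)
  have hi1 := neg_abs_le i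
  have hi2 := le_abs_self i
  have hsv : siteVariation f (swapOn A₀ x y) i t = siteVariation f (swapOn A x y) i t := by
    have e : ∀ m, i - r ≤ m → m ≤ i + r → swapOn A₀ x y m = swapOn A x y m := by
      intro m h1 h2
      by_cases hm : m ∈ A
      · rw [swapOn_of_mem hm, swapOn_of_mem ((hAA m (by omega) (by omega)).1 hm)]
      · rw [swapOn_of_notMem hm,
          swapOn_of_notMem fun h => hm ((hAA m (by omega) (by omega)).2 h)]
    unfold siteVariation
    refine Finset.sum_congr rfl fun j _ => ?_
    have h1 := one_le_disp j
    have h2 := disp_le j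
    rw [e i (by omega) (by omega), e (i + disp j) (by omega) (by omega),
      e (i - disp j) (by omega) (by omega)]
  have hle := hf.linkEnergy_swapOn_le hy hu (by omega : a ≤ b) hA
  have hup := linkEnergy_update f (by omega : a ≤ i) (by omega : i ≤ b) (swapOn A x y) t
  have hmin := hx a b (by omega) (Function.update (swapOn A x y) i (swapOn A x y i + t)) (by
    intro m hm
    have hne : m ≠ i := by rintro rfl; exact hm ⟨by omega, by omega⟩
    rw [Function.update_of_ne hne]
    exact swapOn_of_notMem (fun h => hm (hA h)) _ _)
  have hneg : 0 ≤ lam * cutSum r A (Finset.Icc (a - r) b) (negLink u) := by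
    refine mul_nonneg hf.lam_pos.le (Finset.sum_nonneg fun m _ => Finset.sum_nonneg fun j _ => ?_)
    split_ifs
    · exact le_rfl
    · exact negLink_nonneg _ _ _
  have hpos : K / r * cutSum r A (Finset.Icc (a - r) b) (posLink u) ≤ ε := by
    rwa [mul_comm, ← le_div_iff₀ hκ]
  rw [hsv]
  linarith

/-- If exchanging two minimizers on a set where `y < x` costs arbitrarily little energy, then the
set is trivial. -/
lemma eq_empty_or_univ_of_cutSum_small (hf : IsPotentialFamily K lam f) {x y u : ℤ → ℝ}
    (hx : IsMinimizing f x) (hy : IsMinimizing f y) (hu : ∀ m, u m = x m - y m) {A₀ : Set ℤ}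
    (hpos : ∀ m ∈ A₀, 0 < u m)
    (hA₀ : ∀ n : ℤ, 0 ≤ n → ∀ ε > 0, ∃ A : Set ℤ, ∃ a b : ℤ, a ≤ -n ∧ n ≤ b ∧ A ⊆ Set.Icc a b ∧
      (∀ m, -n ≤ m → m ≤ n → (m ∈ A ↔ m ∈ A₀)) ∧
      cutSum r A (Finset.Icc (a - r) b) (posLink u) ≤ ε) :
    A₀ = ∅ ∨ A₀ = Set.univ := by
  by_cases hne : ∃ i₀, i₀ ∉ A₀
  swap
  · right
    rw [Set.eq_univ_iff_forall]
    push Not at hne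
    exact hne
  left
  obtain ⟨i₀, hi₀⟩ := hne
  have hst := hf.energyGradient_swapOn_eq_zero hx hy hu hA₀
  have hv : ∀ m, 0 ≤ x m - swapOn A₀ x y m := by
    intro m
    by_cases hm : m ∈ A₀
    · rw [swapOn_of_mem hm, ← hu]; exact (hpos m hm).le
    · rw [swapOn_of_notMem hm, sub_self]
  -- Strong maximum principle: `x` minus the hybrid is nonnegative and vanishes off `A₀`; by
  -- Harnack, a zero at `i` forces zeros at both neighbours.
  have hstep : ∀ i, i ∉ A₀ → i + 1 ∉ A₀ ∧ i - 1 ∉ A₀ := by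
    intro i hi
    have hz : x i - swapOn A₀ x y i = 0 := by rw [swapOn_of_notMem hi, sub_self]
    have h := hf.le_of_nonneg (hf.energyGradient_eq_zero hx i) (hst i)
      (u := fun m => x m - swapOn A₀ x y m) (fun m => rfl) (fun m _ _ => hv m)
    simp only [hz, mul_zero] at h
    have hl := hf.lam_pos
    constructor
    · intro hm
      have h2 := hpos _ hm
      have h1 := h.1
      rw [swapOn_of_mem hm, ← hu] at h1
      nlinarith
    · intro hm
      have h2 := hpos _ hm
      have h1 := h.2
      rw [swapOn_of_mem hm, ← hu] at h1
      nlinarith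
  rw [Set.eq_empty_iff_forall_notMem]
  intro m
  induction m using Int.inductionOn' (b := i₀) with
  | zero => exact hi₀
  | succ k _ ih => exact (hstep k ih).1
  | pred k _ ih => exact (hstep k ih).2

/-- A bounded set on which `y < x` and whose neighbours satisfy `x ≤ y` is empty. -/
lemma eq_empty_of_bounded (hf : IsPotentialFamily K lam f) {x y u : ℤ → ℝ}
    (hx : IsMinimizing f x) (hy : IsMinimizing f y) (hu : ∀ m, u m = x m - y m) {A : Set ℤ}
    {a b : ℤ} (hab : A ⊆ Set.Icc a b) (hpos : ∀ m ∈ A, 0 < u m)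
    (hnb : ∀ m ∈ A, ∀ k, k ∉ A → m - r ≤ k → k ≤ m + r → u k ≤ 0) : A = ∅ := by
  -- The set itself serves as every approximation: each cut link joins a positive value to a
  -- nonpositive one, so the cost is zero.
  rcases hf.eq_empty_or_univ_of_cutSum_small hx hy hu hpos (fun n _ ε hε =>
    ⟨A, min a (-n), max b n, min_le_right _ _, le_max_right _ _,
      hab.trans (Set.Icc_subset_Icc (min_le_left _ _) (le_max_left _ _)), fun m _ _ => Iff.rfl, by
      refine le_trans (le_of_eq ?_) hε.le
      refine Finset.sum_eq_zero fun i _ => Finset.sum_eq_zero fun j _ => ?_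
      have h1 := one_le_disp j
      have h2 := disp_le j
      split_ifs with h
      · rfl
      · refine max_eq_right ?_
        by_cases hi : i ∈ A
        · have hk : i + disp j ∉ A := fun hk => h (iff_of_true hi hk)
          have := hpos i hi
          have := hnb i hi _ hk (by omega) (by omega)
          nlinarith
        · have hk : i + disp j ∈ A := by
            by_contra hk
            exact h (iff_of_false hi hk)
          have := hpos _ hk
          have := hnb _ hk i hi (by omega) (by omega)
          nlinarith⟩) with h | h
  · exact h
  · exfalso
    have : b + 1 ∈ A := by rw [h]; trivial
    have := (hab this).2
    omega

end IsPotentialFamily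

/-- A bound for the links across `q` joins to a bound for cutting `{u > 0}` at both ends of an
interval. -/
lemma cutSum_interval_le {u : ℤ → ℝ} {a b : ℤ} {α β : ℝ} (hα : 0 ≤ α) (hβ : 0 ≤ β)
    (ha : ∀ i k, i < a → a ≤ k → k ≤ i + r → 0 < u i → 0 < u k → u i * u k ≤ α)
    (hb : ∀ i k, i ≤ b → b < k → k ≤ i + r → 0 < u i → 0 < u k → u i * u k ≤ β) :
    cutSum r ({m | 0 < u m} ∩ Set.Icc a b) (Finset.Icc (a - r) b) (posLink u) ≤
      r ^ 2 * (α + β) := by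
  classical
  -- A cut link with two positive ends must straddle `a` or `b`; at each end it starts in one of `r`
  -- sites, with `r` links per site.
  unfold cutSum
  refine (Finset.sum_le_sum (g := fun i => (if i ∈ Finset.Ico (a - r) a then r * α else 0) +
    (if i ∈ Finset.Ioc (b - r) b then r * β else 0)) fun i hi => ?_).trans ?_
  · rw [Finset.mem_Icc] at hi
    have hnn : ∀ P Q : Prop, [Decidable P] → [Decidable Q] →
        (0 : ℝ) ≤ (if P then α else 0) + (if Q then β else 0) := by
      intro P Q _ _
      split_ifs <;> positivity
    have e : (if i ∈ Finset.Ico (a - r) a then r * α else 0) +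
        (if i ∈ Finset.Ioc (b - r) b then r * β else 0) =
        ∑ j : Fin r, ((if i ∈ Finset.Ico (a - r) a then α else 0) +
        (if i ∈ Finset.Ioc (b - r) b then β else 0)) := by
      rw [Finset.sum_const, Finset.card_univ, Fintype.card_fin, nsmul_eq_mul, mul_add, mul_ite,
        mul_ite, mul_zero]
    rw [e]
    refine Finset.sum_le_sum fun j _ => ?_
    have h1 := one_le_disp j
    have h2 := disp_le j
    split_ifs with hc hL hR hR hL hR hR <;> first | positivity | skip
    all_goals
      simp only [Set.mem_inter_iff, Set.mem_ofPred_eq, Set.mem_Icc] at hc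
      refine max_le ?_ (by positivity)
      by_contra! hlt
      have hui : 0 < u i ∧ 0 < u (i + disp j) := by
        by_contra hn
        by_cases p1 : 0 < u i
        · have p2 : ¬ 0 < u (i + disp j) := fun p2 => hn ⟨p1, p2⟩
          nlinarith
        · by_cases p2 : 0 < u (i + disp j)
          · nlinarith
          · exact hc (iff_of_false (fun h => p1 h.1) (fun h => p2 h.1))
      simp only [hui.1, hui.2, true_and] at hc
      simp only [Finset.mem_Ico, Finset.mem_Ioc] at hL hR
      by_cases hia : i < a
      · have := ha i (i + disp j) hia (by omega) (by omega) hui.1 hui.2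
        first | linarith | omega
      · have := hb i (i + disp j) (by omega) (by omega) (by omega) hui.1 hui.2
        first | linarith | omega
  rw [Finset.sum_add_distrib, ← Finset.sum_filter, ← Finset.sum_filter, Finset.sum_const,
    Finset.sum_const, nsmul_eq_mul, nsmul_eq_mul]
  have c1 : ((Finset.Icc (a - r) b).filter (· ∈ Finset.Ico (a - r) a)).card ≤ r := by
    refine (Finset.card_le_card (t := Finset.Ico (a - r) a) fun m hm =>
      (Finset.mem_filter.1 hm).2).trans ?_
    simp
  have c2 : ((Finset.Icc (a - r) b).filter (· ∈ Finset.Ioc (b - r) b)).card ≤ r := by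
    refine (Finset.card_le_card (t := Finset.Ioc (b - r) b) fun m hm =>
      (Finset.mem_filter.1 hm).2).trans ?_
    simp
  have c1' : (((Finset.Icc (a - r) b).filter (· ∈ Finset.Ico (a - r) a)).card : ℝ) ≤ r := by
    exact_mod_cast c1
  have c2' : (((Finset.Icc (a - r) b).filter (· ∈ Finset.Ioc (b - r) b)).card : ℝ) ≤ r := by
    exact_mod_cast c2
  have := mul_le_mul_of_nonneg_right c1' (by positivity : (0 : ℝ) ≤ r * α)
  have := mul_le_mul_of_nonneg_right c2' (by positivity : (0 : ℝ) ≤ r * β)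
  linarith

namespace IsPotentialFamily

variable {K lam : ℝ} {f : Fin r → ℝ × ℝ → ℝ}

/-- Two minimizers are ordered as soon as the links across suitable far away sites are
negligible on the set where `y < x`. -/
lemma le_or_le_of_links_small (hf : IsPotentialFamily K lam f) {x y u : ℤ → ℝ}
    (hx : IsMinimizing f x) (hy : IsMinimizing f y) (hu : ∀ m, u m = x m - y m)
    (hR : ∀ n : ℤ, ∀ ε > 0, ∃ b, n ≤ b ∧
      ∀ i k, i ≤ b → b < k → k ≤ i + r → 0 < u i → 0 < u k → u i * u k ≤ ε)
    (hL : ∀ n : ℤ, ∀ ε > 0, ∃ a, a ≤ -n ∧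
      ∀ i k, i < a → a ≤ k → k ≤ i + r → 0 < u i → 0 < u k → u i * u k ≤ ε) :
    x ≤ y ∨ y ≤ x := by
  have hr := hf.range_pos
  rcases hf.eq_empty_or_univ_of_cutSum_small hx hy hu (A₀ := {m | 0 < u m}) (fun m hm => hm)
    (fun n _ ε hε => by
      obtain ⟨b, hb, hb'⟩ := hR n (ε / (2 * r ^ 2)) (by positivity)
      obtain ⟨a, ha, ha'⟩ := hL n (ε / (2 * r ^ 2)) (by positivity)
      refine ⟨{m | 0 < u m} ∩ Set.Icc a b, a, b, ha, hb, Set.inter_subset_right, fun m h1 h2 =>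
        ⟨fun h => h.1, fun h => ⟨h, by omega, by omega⟩⟩, ?_⟩
      refine (cutSum_interval_le (by positivity) (by positivity) ha' hb').trans (le_of_eq ?_)
      field_simp; ring) with h | h
  · left
    intro m
    have : m ∉ {m | 0 < u m} := by rw [h]; exact Set.notMem_empty m
    have : u m ≤ 0 := not_lt.1 this
    linarith [hu m]
  · right
    intro m
    have : m ∈ {m | 0 < u m} := by rw [h]; trivial
    have : 0 < u m := this
    linarith [hu m]

end IsPotentialFamily

/-! ### Exponential growth of the crossings. -/

/-- The total weight of the sign changing links starting in the sites `a, …, b`. -/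
noncomputable def crossingSum (r : ℕ) (u : ℤ → ℝ) (a b : ℤ) : ℝ :=
  ∑ i ∈ Finset.Icc a b, ∑ j : Fin r, negLink u i (i + disp j)

lemma sum_negLink_nonneg (u : ℤ → ℝ) (i : ℤ) : 0 ≤ ∑ j : Fin r, negLink u i (i + disp j) :=
  Finset.sum_nonneg fun _ _ => negLink_nonneg _ _ _

lemma crossingSum_nonneg (u : ℤ → ℝ) (a b : ℤ) : 0 ≤ crossingSum r u a b :=
  Finset.sum_nonneg fun _ _ => sum_negLink_nonneg _ _

lemma crossingSum_add_le (u : ℤ → ℝ) {n a b c d m : ℤ} (h1 : -m ≤ a) (h2 : b < -n) (h3 : n < c)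
    (h4 : d ≤ m) (hn : 0 ≤ n) (hm : n ≤ m) :
    crossingSum r u (-n) n + (crossingSum r u a b + crossingSum r u c d) ≤
      crossingSum r u (-m) m := by
  unfold crossingSum
  rw [← Finset.sum_union, ← Finset.sum_union]
  · refine Finset.sum_le_sum_of_subset_of_nonneg ?_ fun i _ _ => sum_negLink_nonneg _ _
    intro i hi
    simp only [Finset.mem_union, Finset.mem_Icc] at hi ⊢
    omega
  · rw [Finset.disjoint_left]
    intro i hi hi'
    simp only [Finset.mem_union, Finset.mem_Icc] at hi hi'
    omega
  · rw [Finset.disjoint_left]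
    intro i hi hi'
    simp only [Finset.mem_Icc] at hi hi'
    omega

lemma negLink_le_crossingSum (u : ℤ → ℝ) {a b i k : ℤ} (h1 : a ≤ i) (h2 : i ≤ b) (h3 : i < k)
    (h4 : k ≤ i + r) : negLink u i k ≤ crossingSum r u a b := by
  obtain ⟨j, hj⟩ := exists_disp_eq (r := r) (m := k - i) (by omega) (by omega)
  have e : k = i + disp j := by omega
  rw [e]
  exact (Finset.single_le_sum (f := fun j : Fin r => negLink u i (i + disp j))
    (fun j _ => negLink_nonneg _ _ _) (Finset.mem_univ j)).trans
    (Finset.single_le_sum (f := fun i => ∑ j : Fin r, negLink u i (i + disp j))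
      (fun i _ => sum_negLink_nonneg _ _) (Finset.mem_Icc.2 ⟨h1, h2⟩))

lemma neg_mul_le_crossingSum (u : ℤ → ℝ) {q i k : ℤ} (hi1 : q - r ≤ i) (hi2 : i ≤ q + r)
    (hk1 : q - r ≤ k) (hk2 : k ≤ q + r) (h3 : k ≤ i + r) (h4 : i ≤ k + r) (hne : i ≠ k) :
    -(u i * u k) ≤ crossingSum r u (q - r) (q + r) := by
  rcases lt_or_gt_of_ne hne with h | h
  · exact (le_max_left _ _).trans (negLink_le_crossingSum u hi1 hi2 h h3)
  · rw [mul_comm]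
    exact (le_max_left _ _).trans (negLink_le_crossingSum u hk1 hk2 h h4)

/-- The margins keep both ends of the links in `[a, b]`; there, a link not cut by `{u > 0}` has ends
of equal weak sign and no negative part. -/
lemma crossingSum_le_cutSum {u : ℤ → ℝ} {n a b : ℤ} (ha : a ≤ -n) (hb : n + r ≤ b) :
    crossingSum r u (-n) n ≤
      cutSum r ({m | 0 < u m} ∩ Set.Icc a b) (Finset.Icc (a - r) b) (negLink u) := by
  classical
  unfold cutSum crossingSum
  refine (Finset.sum_le_sum fun i hi => Finset.sum_le_sum fun j _ => ?_).trans
    (Finset.sum_le_sum_of_subset_of_nonneg (s := Finset.Icc (-n) n) ?_ fun i _ _ =>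
      Finset.sum_nonneg fun j _ => ?_)
  · have h1 := one_le_disp j
    have h2 := disp_le j
    rw [Finset.mem_Icc] at hi
    split_ifs with hc
    · have hia : i ∈ Set.Icc a b := ⟨by omega, by omega⟩
      have hka : i + disp j ∈ Set.Icc a b := ⟨by omega, by omega⟩
      simp only [Set.mem_inter_iff, hia, hka, and_true, Set.mem_ofPred_eq] at hc
      refine max_le ?_ le_rfl
      by_cases hp : 0 < u i
      · have := hc.1 hp
        nlinarith
      · have : ¬ 0 < u (i + disp j) := fun h => hp (hc.2 h)
        nlinarith
    · exact le_rfl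
  · exact Finset.Icc_subset_Icc (by omega) (by omega)
  · split_ifs
    · exact le_rfl
    · exact negLink_nonneg _ _ _

/-- A sequence growing by a fixed factor cannot be bounded by a slower exponential times a
linear term. -/
lemma eq_zero_of_two_pow_mul_le {s A B θ : ℝ} (hs : 0 ≤ s) (hθ : 0 ≤ θ) (hθ2 : θ < 2)
    (h : ∀ j : ℕ, 2 ^ j * s ≤ (A + B * j) * θ ^ j) : s = 0 := by
  refine le_antisymm ?_ hs
  have hq : |θ / 2| < 1 := by rw [abs_of_nonneg (by positivity)]; linarith
  have t0 := tendsto_pow_const_mul_const_pow_of_abs_lt_one 0 hq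
  have t1 := tendsto_pow_const_mul_const_pow_of_abs_lt_one 1 hq
  have t := (t0.const_mul A).add (t1.const_mul B)
  simp only [mul_zero, add_zero] at t
  refine ge_of_tendsto' t fun j => ?_
  have h2 : (0 : ℝ) < 2 ^ j := by positivity
  have := h j
  rw [div_pow, pow_zero, pow_one]
  have e : A * (1 * (θ ^ j / 2 ^ j)) + B * (j * (θ ^ j / 2 ^ j)) =
    (A + B * j) * θ ^ j / 2 ^ j := by ring
  rw [e, le_div_iff₀ h2]
  linarith

lemma crossingSum_le_of_exp_bound {u : ℤ → ℝ} {C b : ℝ} (hC : 0 ≤ C) (hb : 0 ≤ b)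
    (hu : ∀ i : ℤ, |u i| ≤ C * (2 : ℝ) ^ (b * |(i : ℝ)|)) {n : ℤ} (hn : 0 ≤ n) :
    crossingSum r u (-n) n ≤ (2 * n + 1) * (r * (C * 2 ^ (b * (n + r))) ^ 2) := by
  have hbd : ∀ i : ℤ, |i| ≤ n + r → |u i| ≤ C * 2 ^ (b * (n + r : ℝ)) := by
    intro i hi
    refine (hu i).trans ?_
    have : |(i : ℝ)| ≤ n + r := by exact_mod_cast hi
    gcongr
    norm_num
  have hcard : ((Finset.Icc (-n) n).card : ℝ) = 2 * n + 1 := by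
    rw [Int.card_Icc]
    have : ((n + 1 - -n).toNat : ℤ) = 2 * n + 1 := by omega
    exact_mod_cast this
  rw [← hcard, ← nsmul_eq_mul]
  refine Finset.sum_le_card_nsmul _ _ _ fun i hi => ?_
  rw [Finset.mem_Icc] at hi
  have h3 : (r : ℝ) * (C * 2 ^ (b * (n + r : ℝ))) ^ 2 =
    (Finset.univ : Finset (Fin r)).card • (C * 2 ^ (b * (n + r : ℝ))) ^ 2 := by
    rw [Finset.card_univ, Fintype.card_fin, nsmul_eq_mul]
  rw [h3]
  refine Finset.sum_le_card_nsmul _ _ _ fun j _ => ?_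
  have h1 := one_le_disp j
  have h2 := disp_le j
  refine max_le ?_ (by positivity)
  refine (neg_le_abs _).trans ?_
  rw [abs_mul, sq]
  gcongr
  · exact hbd i (abs_le.2 ⟨by omega, by omega⟩)
  · exact hbd _ (abs_le.2 ⟨by omega, by omega⟩)

namespace IsPotentialFamily

variable {K lam : ℝ} {f : Fin r → ℝ × ℝ → ℝ}

/-- Two positive values across a nonpositive one are controlled by the nearby crossings. -/
lemma mul_le_crossingSum (hf : IsPotentialFamily K lam f) {x y u : ℤ → ℝ}
    (hx : IsMinimizing f x) (hy : IsMinimizing f y) (hu : ∀ m, u m = x m - y m)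
    {q i k : ℤ} (hq : u q ≤ 0) (hiq : i ≤ q) (hqk : q ≤ k) (hk : k ≤ i + r)
    (hi0 : 0 < u i) (hk0 : 0 < u k) :
    u i * u k ≤ 4 * K / lam * crossingSum r u (q - r) (q + r) := by
  have hl := hf.lam_pos
  have hK := hf.K_pos
  -- Applying `exists_neg_ge` to the larger of `u i` and `u k` gives one site `p` dominating both.
  obtain ⟨p, hp1, hp2, hpi, hpk⟩ : ∃ p, q - r ≤ p ∧ p ≤ q + r ∧
      lam * u i ≤ 4 * K * (-u p) ∧ lam * u k ≤ 4 * K * (-u p) := by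
    rcases le_total (u i) (u k) with h | h
    · obtain ⟨p, h1, h2, h3⟩ := hf.exists_neg_ge (hf.energyGradient_eq_zero hx q)
        (hf.energyGradient_eq_zero hy q) hu hq hk0 (by omega) (by omega)
      exact ⟨p, h1, h2, by nlinarith, h3⟩
    · obtain ⟨p, h1, h2, h3⟩ := hf.exists_neg_ge (hf.energyGradient_eq_zero hx q)
        (hf.energyGradient_eq_zero hy q) hu hq hi0 (by omega) (by omega)
      exact ⟨p, h1, h2, h3, by nlinarith⟩
  have hp0 : u p < 0 := by
    have : 0 < lam * u i := by positivity
    nlinarith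
  rw [div_mul_eq_mul_div, le_div_iff₀ hl]
  -- Pair `p` with whichever of `i`, `k` lies on its side of `q`: their distance is then at most
  -- `r`, so they form a link.
  rcases le_total p q with h | h
  · have hc := neg_mul_le_crossingSum (r := r) u (q := q) (i := i) (k := p) (by omega) (by omega)
      (by omega) (by omega) (by omega) (by omega) (by rintro rfl; linarith)
    calc u i * u k * lam = u i * (lam * u k) := by ring
      _ ≤ u i * (4 * K * (-u p)) := by gcongr
      _ = 4 * K * (-(u i * u p)) := by ring
      _ ≤ _ := by gcongr
  · have hc := neg_mul_le_crossingSum (r := r) u (q := q) (i := k) (k := p) (by omega) (by omega)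
      (by omega) (by omega) (by omega) (by omega) (by rintro rfl; linarith)
    calc u i * u k * lam = u k * (lam * u i) := by ring
      _ ≤ u k * (4 * K * (-u p)) := by gcongr
      _ = 4 * K * (-(u k * u p)) := by ring
      _ ≤ _ := by gcongr

/-- The interior crossings are paid for by the links cut at the ends, which `mul_le_crossingSum`
bounds by crossings near `a` and `b`. The constant is `(K / r) * r ^ 2 * (4 * K / lam)`, cleared of
denominators. -/
lemma sq_mul_crossingSum_le (hf : IsPotentialFamily K lam f) {x y u : ℤ → ℝ}
    (hx : IsMinimizing f x) (hy : IsMinimizing f y) (hu : ∀ m, u m = x m - y m)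
    {n a b : ℤ} (hn : 0 ≤ n) (ha : a ≤ -n) (hb : n + r ≤ b) (hua : u a ≤ 0) (hub : u b ≤ 0) :
    lam ^ 2 * crossingSum r u (-n) n ≤ 4 * K ^ 2 * r *
      (crossingSum r u (a - r) (a + r) + crossingSum r u (b - r) (b + r)) := by
  have hl := hf.lam_pos
  have hK := hf.K_pos
  have hr := hf.range_pos
  have h1 := hf.cutSum_negLink_le hx hy hu (A := {m | 0 < u m} ∩ Set.Icc a b) (by omega : a ≤ b)
    Set.inter_subset_right
  have h2 := crossingSum_le_cutSum (u := u) ha hb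
  have h3 := cutSum_interval_le (r := r) (u := u) (a := a) (b := b)
    (α := 4 * K / lam * crossingSum r u (a - r) (a + r))
    (β := 4 * K / lam * crossingSum r u (b - r) (b + r))
    (mul_nonneg (by positivity) (crossingSum_nonneg _ _ _))
    (mul_nonneg (by positivity) (crossingSum_nonneg _ _ _))
    (fun i k hi hk hki hi0 hk0 => hf.mul_le_crossingSum hx hy hu hua hi.le hk hki hi0 hk0)
    (fun i k hi hk hki hi0 hk0 => hf.mul_le_crossingSum hx hy hu hub hi hk.le hki hi0 hk0)
  have h4 := mul_le_mul_of_nonneg_left h3 (div_pos hK hr).le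
  have h5 := mul_le_mul_of_nonneg_left h2 hl.le
  have h6 := mul_le_mul_of_nonneg_left (h5.trans (h1.trans h4)) hl.le
  calc _ = lam * (lam * crossingSum r u (-n) n) := by ring
    _ ≤ _ := h6
    _ = _ := by field_simp

/-- Two minimizers whose difference grows slowly and is nonpositive at sites with bounded gaps
on both sides are ordered. -/
lemma le_or_le_of_frequently_nonpos (hf : IsPotentialFamily K lam f) {x y u : ℤ → ℝ}
    (hx : IsMinimizing f x) (hy : IsMinimizing f y) (hu : ∀ m, u m = x m - y m)
    {C b : ℝ} (hC : 0 ≤ C) (hb : 0 ≤ b) (hexp : ∀ i : ℤ, |u i| ≤ C * (2 : ℝ) ^ (b * |(i : ℝ)|))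
    {N : ℕ} (hN : 4 * K ^ 2 * r ≤ N * lam ^ 2) (hNb : 6 * r * N * b < 1) {n₀ : ℤ}
    (hR : ∀ n, n₀ ≤ n → ∃ q, n < q ∧ q ≤ n + r ∧ u q ≤ 0)
    (hL : ∀ n, n₀ ≤ n → ∃ q, -n - r ≤ q ∧ q < -n ∧ u q ≤ 0) : x ≤ y ∨ y ≤ x := by
  have hl := hf.lam_pos
  have hK := hf.K_pos
  have hr := hf.range_pos
  set δ : ℝ := lam ^ 2 / (4 * K ^ 2 * r) with hδ
  have hδ0 : 0 < δ := by positivity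
  have hstep : ∀ n, 0 ≤ n → n₀ ≤ n →
      (1 + δ) * crossingSum r u (-n) n ≤ crossingSum r u (-(n + 3 * r)) (n + 3 * r) := by
    intro n hn hn0
    -- Starting from `n + r` puts the windows of radius `r` around `p` and `q` outside `[-n, n]` but
    -- inside `[-(n + 3 * r), n + 3 * r]`, so their crossings add to those of `[-n, n]`.
    obtain ⟨q, h1, h2, h3⟩ := hR (n + r) (by omega)
    obtain ⟨p, g1, g2, g3⟩ := hL (n + r) (by omega)
    have hA := hf.sq_mul_crossingSum_le hx hy hu (n := n) (a := p) (b := q) hn (by omega)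
      (by omega) g3 h3
    have hB := crossingSum_add_le (r := r) u (n := n) (a := p - r) (b := p + r) (c := q - r)
      (d := q + r) (m := n + 3 * r) (by omega) (by omega) (by omega) (by omega) hn (by omega)
    have hD : δ * crossingSum r u (-n) n ≤
        crossingSum r u (p - r) (p + r) + crossingSum r u (q - r) (q + r) := by
      rw [hδ, div_mul_eq_mul_div, div_le_iff₀ (by positivity)]
      linarith
    linarith
  have hzero : ∀ n, 0 ≤ n → n₀ ≤ n → crossingSum r u (-n) n = 0 := by
    intro n hn hn0
    have hpow : ∀ j : ℕ, (1 + δ) ^ j * crossingSum r u (-n) n ≤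
        crossingSum r u (-(n + 3 * r * j)) (n + 3 * r * j) := by
      intro j
      induction j with
      | zero => simp
      | succ j ih =>
        have h1 : (0 : ℤ) ≤ 3 * r * j := by positivity
        have h2 := hstep (n + 3 * r * j) (by omega) (by omega)
        have e : n + 3 * (r : ℤ) * ((j + 1 : ℕ) : ℤ) = n + 3 * r * j + 3 * r := by
          push_cast; ring
        rw [e]
        refine le_trans ?_ h2
        rw [pow_succ]
        nlinarith
    -- Bernoulli: `N` steps, that is `3 * r * N` sites on each side, double the crossing sum. Over
    -- that distance the square of the bound on `u` grows only by the factor `2 ^ (6 * r * N * b) <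
    -- 2`.
    have htwo : 2 ≤ (1 + δ) ^ N := by
      have h1 := one_add_mul_le_pow (by linarith : -2 ≤ δ) N
      have h2 : 1 ≤ N * δ := by
        rw [hδ, ← mul_div_assoc, le_div_iff₀ (by positivity)]
        linarith
      linarith
    refine eq_zero_of_two_pow_mul_le (θ := 2 ^ (6 * r * N * b))
      (A := (2 * n + 1) * (r * (C * 2 ^ (b * (n + r))) ^ 2))
      (B := 6 * r * N * (r * (C * 2 ^ (b * (n + r))) ^ 2))
      (crossingSum_nonneg _ _ _) (by positivity) ?_ fun j => ?_
    · calc (2 : ℝ) ^ (6 * r * N * b) < 2 ^ (1 : ℝ) :=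
          Real.rpow_lt_rpow_of_exponent_lt (by norm_num) hNb
        _ = 2 := Real.rpow_one 2
    · have h1 := hpow (N * j)
      rw [pow_mul] at h1
      have h2 : (2 : ℝ) ^ j * crossingSum r u (-n) n ≤
          ((1 + δ) ^ N) ^ j * crossingSum r u (-n) n := by
        gcongr
        exact crossingSum_nonneg _ _ _
      have h0 : (0 : ℤ) ≤ 3 * r * ((N * j : ℕ) : ℤ) := by positivity
      have h3 := crossingSum_le_of_exp_bound (r := r) hC hb hexp
        (n := n + 3 * r * ((N * j : ℕ) : ℤ)) (by omega)
      refine (h2.trans (h1.trans h3)).trans (le_of_eq ?_)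
      push_cast
      have e1 : (2 : ℝ) ^ (b * ((n : ℝ) + 3 * r * (N * j) + r)) =
          2 ^ (b * ((n : ℝ) + r)) * 2 ^ (b * (3 * r * (N * j) : ℝ)) := by
        rw [← Real.rpow_add (by norm_num)]
        congr 1; ring
      have e2 : ((2 : ℝ) ^ (b * (3 * r * (N * j) : ℝ))) ^ 2 = (2 ^ (6 * r * N * b)) ^ j := by
        rw [← Real.rpow_mul_natCast (by norm_num), ← Real.rpow_mul_natCast (by norm_num)]
        congr 1; push_cast; ring
      rw [e1, ← e2]
      ring
  have hT : ∀ q, crossingSum r u (q - r) (q + r) = 0 := by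
    intro q
    refine le_antisymm ?_ (crossingSum_nonneg _ _ _)
    have h1 := neg_abs_le q
    have h2 := le_abs_self q
    have h3 := le_abs_self n₀
    have h4 := abs_nonneg n₀
    have h5 := abs_nonneg q
    rw [← hzero (|q| + r + |n₀|) (by omega) (by omega)]
    exact Finset.sum_le_sum_of_subset_of_nonneg (Finset.Icc_subset_Icc (by omega) (by omega))
      fun i _ _ => sum_negLink_nonneg _ _
  refine hf.le_or_le_of_links_small hx hy hu (fun n ε hε => ?_) (fun n ε hε => ?_)
  · obtain ⟨q, h1, h2, h3⟩ := hR (max n n₀) (le_max_right _ _)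
    have := le_max_left n n₀
    refine ⟨q, by omega, fun i k hi hk hki hi0 hk0 => ?_⟩
    have := hf.mul_le_crossingSum hx hy hu h3 hi hk.le hki hi0 hk0
    rw [hT, mul_zero] at this
    linarith
  · obtain ⟨q, h1, h2, h3⟩ := hL (max n n₀) (le_max_right _ _)
    have := le_max_left n n₀
    refine ⟨q, by omega, fun i k hi hk hki hi0 hk0 => ?_⟩
    have := hf.mul_le_crossingSum hx hy hu h3 hi.le hk hki hi0 hk0
    rw [hT, mul_zero] at this
    linarith

end IsPotentialFamily

/-! ### One-signed ends and single crossings. -/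

/-- Along a sequence whose increments over `k` steps are nonnegative and satisfy a Harnack
inequality, either the increments tend to zero or the sequence tends to infinity. -/
lemma eventually_ge_of_increments {v u : ℤ → ℝ} {k L : ℤ} (hk : 0 < k) {C : ℝ}
    (hu : ∀ i, u i = v i - v (i - k)) (hn : ∀ i, L ≤ i → 0 ≤ u i)
    (hC : ∀ i, L ≤ i → u (i + 1) ≤ C * u i)
    (hsmall : ¬ ∀ ε > 0, ∃ N : ℤ, ∀ i, N ≤ i → u i ≤ ε) (M : ℝ) :
    ∃ N : ℤ, ∀ i, N ≤ i → M ≤ v i := by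
  have hinc : ∀ i₀ : ℤ, ∀ n : ℕ,
      v (i₀ + k * ((n + 1 : ℕ) : ℤ)) - v (i₀ + k * n) = u (i₀ + k * ((n + 1 : ℕ) : ℤ)) := by
    intro i₀ n
    rw [hu]
    congr 2; push_cast; ring
  have hge : ∀ i₀ : ℤ, ∀ n : ℕ, i₀ ≤ i₀ + k * n := fun i₀ n => by
    have : 0 ≤ k * (n : ℤ) := by positivity
    omega
  have hmono : ∀ i₀, L ≤ i₀ → Monotone fun n : ℕ => v (i₀ + k * n) := by
    intro i₀ h
    refine monotone_nat_of_le_succ fun n => ?_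
    have := hn _ (h.trans (hge i₀ (n + 1)))
    rw [← hinc] at this
    linarith
  have hC1 : ∀ i, L ≤ i → ∀ t : ℕ, u (i + t) ≤ (max C 1) ^ t * u i := by
    intro i hi t
    induction t with
    | zero => simp
    | succ t ih =>
      have h1 := hC (i + t) (by omega)
      have h2 := hn (i + t) (by omega)
      have e : i + ((t + 1 : ℕ) : ℤ) = i + t + 1 := by push_cast; ring
      rw [e]
      calc _ ≤ C * u (i + t) := h1
        _ ≤ max C 1 * u (i + t) := by gcongr; exact le_max_left _ _
        _ ≤ max C 1 * ((max C 1) ^ t * u i) := by gcongr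
        _ = _ := by ring
  -- Along a residue class mod `k` the sequence is monotone. If it converged, its increments would
  -- tend to zero on that class and, by at most `k - 1` Harnack steps, on all classes.
  have htend : ∀ i₀, L ≤ i₀ → Tendsto (fun n : ℕ => v (i₀ + k * n)) atTop atTop := by
    intro i₀ h
    rcases tendsto_atTop_of_monotone (hmono i₀ h) with ht | ⟨l, hl⟩
    · exact ht
    exfalso
    apply hsmall
    intro ε hε
    have hd := ((tendsto_add_atTop_iff_nat 1).2 hl).sub hl
    simp only [hinc, sub_self] at hd
    have hpos : 0 < (max C 1) ^ k.toNat := by positivity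
    obtain ⟨n, hn1⟩ := eventually_atTop.1
      (hd.eventually_lt_const (div_pos hε hpos : 0 < ε / (max C 1) ^ k.toNat))
    refine ⟨i₀ + k * ((n + 1 : ℕ) : ℤ), fun i hi => ?_⟩
    have hdm := Int.emod_add_mul_ediv (i - i₀) k
    have hm0 := Int.emod_nonneg (i - i₀) hk.ne'
    have hm1 := Int.emod_lt_of_pos (i - i₀) hk
    have hq : ((n + 1 : ℕ) : ℤ) ≤ (i - i₀) / k := by
      rw [Int.le_ediv_iff_mul_le hk, mul_comm]
      omega
    obtain ⟨m, hm⟩ : ∃ m : ℕ, ((m + 1 : ℕ) : ℤ) = (i - i₀) / k :=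
      ⟨((i - i₀) / k - 1).toNat, by omega⟩
    obtain ⟨t, ht⟩ : ∃ t : ℕ, (t : ℤ) = (i - i₀) % k := ⟨((i - i₀) % k).toNat, by omega⟩
    have hi' : i = i₀ + k * ((m + 1 : ℕ) : ℤ) + t := by rw [hm, ht]; omega
    have h1 := hC1 _ (h.trans (hge i₀ (m + 1))) t
    have h2 := hn1 m (by omega)
    have h3 := hn _ (h.trans (hge i₀ (m + 1)))
    rw [lt_div_iff₀ hpos] at h2
    rw [hi']
    calc _ ≤ _ := h1
      _ ≤ (max C 1) ^ k.toNat * u (i₀ + k * ((m + 1 : ℕ) : ℤ)) := by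
        gcongr
        · exact le_max_right _ _
        · omega
      _ ≤ ε := by linarith
  have hall : ∀ᶠ n : ℕ in atTop, ∀ t ∈ Finset.range k.toNat, M ≤ v (L + (t : ℤ) + k * n) := by
    rw [Filter.eventually_all_finset]
    intro t _
    exact (htend (L + t) (by omega)).eventually_ge_atTop M
  obtain ⟨n, hn1⟩ := eventually_atTop.1 hall
  refine ⟨L + k * n, fun i hi => ?_⟩
  have hdm := Int.emod_add_mul_ediv (i - L) k
  have hm0 := Int.emod_nonneg (i - L) hk.ne'
  have hm1 := Int.emod_lt_of_pos (i - L) hk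
  have hq : (n : ℤ) ≤ (i - L) / k := by
    rw [Int.le_ediv_iff_mul_le hk, mul_comm]
    omega
  have h := hn1 ((i - L) / k).toNat (by omega) ((i - L) % k).toNat (by
    rw [Finset.mem_range]; omega)
  have e : L + (((i - L) % k).toNat : ℤ) + k * (((i - L) / k).toNat : ℤ) = i := by
    rw [Int.toNat_of_nonneg hm0, Int.toNat_of_nonneg (by omega)]
    omega
  rwa [e] at h

namespace IsPotentialFamily

variable {K lam : ℝ} {f : Fin r → ℝ × ℝ → ℝ}

lemma apply_add_intCast (hf : IsPotentialFamily K lam f) (j : Fin r) (l : ℤ) (ν μ : ℝ) :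
    f j (ν + l, μ + l) = f j (ν, μ) := by
  induction l using Int.induction_on with
  | zero => simp
  | succ n ih =>
    rw [← ih, ← hf.periodic j (ν + ((n : ℤ) : ℝ)) _]
    push_cast
    simp only [add_assoc]
  | pred n ih =>
    rw [← ih, ← hf.periodic j (ν + ((-(n : ℤ) - 1 : ℤ) : ℝ)) _]
    push_cast
    congr 2 <;> ring

lemma linkEnergy_translate (hf : IsPotentialFamily K lam f) (k l a b : ℤ) (x : ℤ → ℝ) :
    linkEnergy f (Finset.Icc a b) (translate k l x) =
      linkEnergy f (Finset.Icc (a - k) (b - k)) x := by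
  unfold linkEnergy translate
  refine Finset.sum_nbij' (· - k) (· + k) ?_ ?_ ?_ ?_ ?_
  · intro i hi; simp only [Finset.mem_Icc] at hi ⊢; omega
  · intro i hi; simp only [Finset.mem_Icc] at hi ⊢; omega
  · intro i _; ring
  · intro i _; ring
  · intro i _
    refine Finset.sum_congr rfl fun j _ => ?_
    rw [hf.apply_add_intCast]
    congr 3; ring

lemma isMinimizing_translate (hf : IsPotentialFamily K lam f) {x : ℤ → ℝ}
    (hx : IsMinimizing f x) (k l : ℤ) : IsMinimizing f (translate k l x) := by
  intro a b hab z hz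
  have e : z = translate k l (translate (-k) (-l) z) := by
    funext i
    simp [translate]
  rw [e, hf.linkEnergy_translate, hf.linkEnergy_translate]
  have e2 : a - r - k = a - k - r := by ring
  rw [e2]
  refine hx _ _ (by omega) _ fun i hi => ?_
  have := hz (i + k) (fun h => hi ⟨by linarith [h.1], by linarith [h.2]⟩)
  simp only [translate, sub_neg_eq_add]
  rw [this]
  simp [translate]

lemma le_or_le_of_eventually_le (hf : IsPotentialFamily K lam f) {x y u : ℤ → ℝ}
    (hx : IsMinimizing f x) (hy : IsMinimizing f y) (hu : ∀ m, u m = x m - y m)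
    (hR : ∀ ε > 0, ∃ N : ℤ, ∀ i, N ≤ i → u i ≤ ε)
    (hL : ∀ ε > 0, ∃ N : ℤ, ∀ i, i ≤ N → u i ≤ ε) : x ≤ y ∨ y ≤ x := by
  have key : ∀ ε > 0, ∀ s t : ℝ, 0 < s → 0 < t → s ≤ min 1 ε → t ≤ min 1 ε → s * t ≤ ε := by
    intro ε hε s t hs ht h1 h2
    have := min_le_left 1 ε
    have := min_le_right 1 ε
    nlinarith
  refine hf.le_or_le_of_links_small hx hy hu (fun n ε hε => ?_) (fun n ε hε => ?_)
  · obtain ⟨N, hN⟩ := hR (min 1 ε) (by positivity)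
    refine ⟨max n (N + r), le_max_left _ _, fun i k hi hk hki hi0 hk0 => ?_⟩
    have := le_max_right n (N + r)
    exact key ε hε _ _ hi0 hk0 (hN i (by omega)) (hN k (by omega))
  · obtain ⟨N, hN⟩ := hL (min 1 ε) (by positivity)
    refine ⟨min (-n) (N - r), min_le_left _ _, fun i k hi hk hki hi0 hk0 => ?_⟩
    have := min_le_right (-n) (N - r)
    exact key ε hε _ _ hi0 hk0 (hN i (by omega)) (hN k (by omega))

/-- No sign change is possible between two blocks of `r` nonnegative values. -/
lemma nonneg_between (hf : IsPotentialFamily K lam f) {x y u : ℤ → ℝ}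
    (hx : IsMinimizing f x) (hy : IsMinimizing f y) (hu : ∀ m, u m = x m - y m) {n m : ℤ}
    (hn : ∀ q, n < q → q ≤ n + r → 0 ≤ u q) (hm : ∀ q, m < q → q ≤ m + r → 0 ≤ u q) (i : ℤ)
    (h1 : n < i) (h2 : i ≤ m + r) : 0 ≤ u i := by
  -- The negative sites lie strictly between the blocks, and a block of length `r` cannot be jumped
  -- over by a link.
  have h := hf.eq_empty_of_bounded hy hx (u := fun i => -u i) (fun m => by rw [hu]; ring)
    (A := {i | u i < 0} ∩ Set.Icc (n + 1) (m + r)) Set.inter_subset_right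
    (fun i hi => by have : u i < 0 := hi.1; linarith) (by
      rintro i ⟨hi, hi1, hi2⟩ k hk hk1 hk2
      have hi : u i < 0 := hi
      have g1 : n + r < i := by
        by_contra hc
        linarith [hn i (by omega) (by omega)]
      have g2 : i ≤ m := by
        by_contra hc
        linarith [hm i (by omega) (by omega)]
      have : ¬ u k < 0 := fun h => hk ⟨h, by omega, by omega⟩
      linarith)
  by_contra! hc
  have : i ∈ ({i | u i < 0} ∩ Set.Icc (n + 1) (m + r) : Set ℤ) := ⟨hc, by omega, h2⟩
  rw [h] at this
  exact this

lemma eventually_nonneg_right (hf : IsPotentialFamily K lam f) {x y u : ℤ → ℝ}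
    (hx : IsMinimizing f x) (hy : IsMinimizing f y) (hu : ∀ m, u m = x m - y m)
    (h : ∀ L : ℤ, ∃ n, L ≤ n ∧ ∀ q, n < q → q ≤ n + r → 0 < u q) :
    ∃ L : ℤ, ∀ i, L ≤ i → 0 ≤ u i := by
  obtain ⟨n, -, hn⟩ := h 0
  refine ⟨n + 1, fun i hi => ?_⟩
  obtain ⟨m, hm, hm'⟩ := h i
  exact hf.nonneg_between hx hy hu (fun q h1 h2 => (hn q h1 h2).le)
    (fun q h1 h2 => (hm' q h1 h2).le) i (by omega) (by omega)

lemma eventually_nonneg_left (hf : IsPotentialFamily K lam f) {x y u : ℤ → ℝ}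
    (hx : IsMinimizing f x) (hy : IsMinimizing f y) (hu : ∀ m, u m = x m - y m)
    (h : ∀ L : ℤ, ∃ n, L ≤ n ∧ ∀ q, -n - r ≤ q → q < -n → 0 < u q) :
    ∃ L : ℤ, ∀ i, i ≤ L → 0 ≤ u i := by
  obtain ⟨n, -, hn⟩ := h 0
  refine ⟨-n - 1, fun i hi => ?_⟩
  obtain ⟨m, hm, hm'⟩ := h (-i)
  exact hf.nonneg_between hx hy hu (n := -m - r - 1) (m := -n - r - 1)
    (fun q h1 h2 => (hm' q (by omega) (by omega)).le)
    (fun q h1 h2 => (hn q (by omega) (by omega)).le) i (by omega) (by omega)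

/-- If such blocks stopped on both sides, every run of `r` sites far out would contain a nonpositive
value, and `le_or_le_of_frequently_nonpos` would order the sequences. -/
lemma exists_blocks_of_not_ordered (hf : IsPotentialFamily K lam f) {x y u : ℤ → ℝ}
    (hx : IsMinimizing f x) (hy : IsMinimizing f y) (hu : ∀ m, u m = x m - y m)
    {C b : ℝ} (hC : 0 ≤ C) (hb : 0 ≤ b) (hexp : ∀ i : ℤ, |u i| ≤ C * (2 : ℝ) ^ (b * |(i : ℝ)|))
    {N : ℕ} (hN : 4 * K ^ 2 * r ≤ N * lam ^ 2) (hNb : 6 * r * N * b < 1)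
    (hno : ¬ (x ≤ y ∨ y ≤ x)) :
    (∀ L : ℤ, ∃ n, L ≤ n ∧ ∀ q, n < q → q ≤ n + r → 0 < u q) ∨
    (∀ L : ℤ, ∃ n, L ≤ n ∧ ∀ q, -n - r ≤ q → q < -n → 0 < u q) := by
  by_contra! hc
  obtain ⟨⟨n₁, h1⟩, ⟨n₂, h2⟩⟩ := hc
  exact hno (hf.le_or_le_of_frequently_nonpos hx hy hu hC hb hexp hN hNb (n₀ := max n₁ n₂)
    (fun n hn => h1 n ((le_max_left _ _).trans hn))
    (fun n hn => h2 n ((le_max_right _ _).trans hn)))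

/-- Minimizers whose difference grows slowly are ordered or cross in a bounded region only. -/
lemma ordered_or_crossing (hf : IsPotentialFamily K lam f) {x y u : ℤ → ℝ}
    (hx : IsMinimizing f x) (hy : IsMinimizing f y) (hu : ∀ m, u m = x m - y m)
    {C b : ℝ} (hC : 0 ≤ C) (hb : 0 ≤ b) (hexp : ∀ i : ℤ, |u i| ≤ C * (2 : ℝ) ^ (b * |(i : ℝ)|))
    {N : ℕ} (hN : 4 * K ^ 2 * r ≤ N * lam ^ 2) (hNb : 6 * r * N * b < 1) :
    (x ≤ y ∨ y ≤ x) ∨ ∃ L M : ℤ,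
      ((∀ i, L ≤ i → 0 ≤ u i) ∧ ∀ i, i ≤ M → u i ≤ 0) ∨
      ((∀ i, L ≤ i → u i ≤ 0) ∧ ∀ i, i ≤ M → 0 ≤ u i) := by
  by_cases hno : x ≤ y ∨ y ≤ x
  · exact Or.inl hno
  right
  have hr := hf.one_le_range
  have hu' : ∀ m, (fun i => -u i) m = y m - x m := fun m => by simp only [hu]; ring
  have h1 := hf.exists_blocks_of_not_ordered hx hy hu hC hb hexp hN hNb hno
  have h2 := hf.exists_blocks_of_not_ordered hy hx hu' hC hb (by simpa using hexp) hN hNb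
    (fun h => hno h.symm)
  -- Positive and negative blocks cannot recur at the same end, since either kind fixes the weak
  -- sign there; the other two cases are the two crossings.
  rcases h1 with h1 | h1 <;> rcases h2 with h2 | h2
  · obtain ⟨L, hL⟩ := hf.eventually_nonneg_right hy hx hu' h2
    obtain ⟨n, hn, hn'⟩ := h1 L
    have := hL (n + 1) (by omega)
    have := hn' (n + 1) (by omega) (by omega)
    linarith
  · obtain ⟨L, hL⟩ := hf.eventually_nonneg_right hx hy hu h1
    obtain ⟨M, hM⟩ := hf.eventually_nonneg_left hy hx hu' h2
    exact ⟨L, M, Or.inl ⟨hL, fun i hi => neg_nonneg.1 (hM i hi)⟩⟩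
  · obtain ⟨L, hL⟩ := hf.eventually_nonneg_left hx hy hu h1
    obtain ⟨M, hM⟩ := hf.eventually_nonneg_right hy hx hu' h2
    exact ⟨M, L, Or.inr ⟨fun i hi => neg_nonneg.1 (hM i hi), hL⟩⟩
  · obtain ⟨L, hL⟩ := hf.eventually_nonneg_left hy hx hu' h2
    obtain ⟨n, hn, hn'⟩ := h1 (-L)
    have := hL (-n - 1) (by omega)
    have := hn' (-n - 1) (by omega) (by omega)
    linarith

/-- A minimizer does not cross its translate once if it can be compared with periodic
minimizers. -/
lemma ordered_of_crossing (hf : IsPotentialFamily K lam f) {x y u w : ℤ → ℝ}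
    (hx : IsMinimizing f x) (hy : IsMinimizing f y) (hu : ∀ m, u m = x m - y m) {k : ℤ}
    (hk : 0 < k) (hw : ∀ i, u i = w i - w (i - k))
    (hcomp : ∀ m : ℤ, ∃ p q : ℤ → ℝ, IsMinimizing f p ∧ IsMinimizing f q ∧
      ∀ i, m - w i = p i - q i)
    {L M : ℤ} (hL : ∀ i, L ≤ i → 0 ≤ u i) (hM : ∀ i, i ≤ M → u i ≤ 0) : x ≤ y ∨ y ≤ x := by
  have hl := hf.lam_pos
  have hu' : ∀ m, (fun i => -u i) m = y m - x m := fun m => by simp only [hu]; ring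
  by_cases hsR : ∀ ε > 0, ∃ N : ℤ, ∀ i, N ≤ i → u i ≤ ε
  · exact hf.le_or_le_of_eventually_le hx hy hu hsR fun ε hε =>
      ⟨M, fun i hi => (hM i hi).trans hε.le⟩
  by_cases hsL : ∀ ε > 0, ∃ N : ℤ, ∀ i, i ≤ N → -u i ≤ ε
  · exact (hf.le_or_le_of_eventually_le hy hx hu' (fun ε hε =>
      ⟨L, fun i hi => by linarith [hL i hi]⟩) hsL).symm
  exfalso
  have hR : ∀ B : ℝ, ∃ N : ℤ, ∀ i, N ≤ i → B ≤ w i := by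
    refine eventually_ge_of_increments (u := u) (L := L + r) (C := 2 * K / lam) hk hw
      (fun i hi => hL i (by omega)) (fun i hi => ?_) hsR
    rw [div_mul_eq_mul_div, le_div_iff₀ hl, mul_comm]
    exact (hf.le_of_nonneg (hf.energyGradient_eq_zero hx i) (hf.energyGradient_eq_zero hy i) hu
      (fun m h1 _ => hL m (by omega))).1
  -- Reflect the index: the `k`-step increment of `w (-i)` is `-u (-i + k)`, which is nonnegative
  -- far out.
  have hL' : ∀ B : ℝ, ∃ N : ℤ, ∀ i, N ≤ i → B ≤ w (-i) := by
    refine eventually_ge_of_increments (v := fun i => w (-i)) (u := fun i => -u (-i + k))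
      (L := -M + k + r) (C := 2 * K / lam) hk (fun i => ?_) (fun i hi => ?_) (fun i hi => ?_) ?_
    · simp only [hw]
      have e1 : -i + k - k = -i := by ring
      have e2 : -(i - k) = -i + k := by ring
      rw [e1, e2]; ring
    · have := hM (-i + k) (by omega)
      linarith
    · rw [div_mul_eq_mul_div, le_div_iff₀ hl, mul_comm]
      have h := (hf.le_of_nonneg (hf.energyGradient_eq_zero hy (-i + k))
        (hf.energyGradient_eq_zero hx _) hu'
        (fun m _ h1 => neg_nonneg.2 (hM m (by omega)))).2
      have e1 : -(i + 1) + k = -i + k - 1 := by ring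
      rw [e1]
      exact h
    · intro hc
      apply hsL
      intro ε hε
      obtain ⟨N, hN⟩ := hc ε hε
      refine ⟨-N + k, fun i hi => ?_⟩
      have := hN (-i + k) (by omega)
      have e1 : -(-i + k) + k = i := by ring
      simpa only [e1] using this
  -- An integer level is what vertical translates of a minimizer can supply. The sublevel set
  -- contains `0` and is bounded because `w` tends to infinity at both ends.
  obtain ⟨m, hm⟩ := exists_int_gt (w 0)
  obtain ⟨p, q, hp, hq, hpq⟩ := hcomp m
  obtain ⟨N₁, hN₁⟩ := hR m
  obtain ⟨N₂, hN₂⟩ := hL' m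
  have hA := hf.eq_empty_of_bounded hp hq (u := fun i => m - w i) hpq (A := {i | w i < m})
    (a := -N₂) (b := N₁) (fun i hi => by
      have hi : w i < m := hi
      constructor
      · by_contra! hc
        have := hN₂ (-i) (by omega)
        rw [neg_neg] at this
        linarith
      · by_contra! hc
        linarith [hN₁ i hc.le])
    (fun i hi => sub_pos.2 hi) (fun i _ k hk _ _ => by
      have : ¬ w k < m := hk
      linarith)
  have : (0 : ℤ) ∈ {i | w i < m} := hm
  rw [hA] at this
  exact this

end IsPotentialFamily

/-! ### Existence of periodic minimizers and their global minimality. -/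

/-- Sequences with `y_{i + q} = y_i + p`. -/
def IsPeriodicSeq (q p : ℤ) (y : ℤ → ℝ) : Prop := ∀ i, y (i + q) = y i + p

/-- The energy of one period. -/
noncomputable def periodEnergy (f : Fin r → ℝ × ℝ → ℝ) (q : ℤ) (y : ℤ → ℝ) : ℝ :=
  linkEnergy f (Finset.Icc 0 (q - 1)) y

/-- The minimizers of the periodic action. -/
def IsPeriodicMinimizer (f : Fin r → ℝ × ℝ → ℝ) (q p : ℤ) (y : ℤ → ℝ) : Prop :=
  IsPeriodicSeq q p y ∧ ∀ z, IsPeriodicSeq q p z → periodEnergy f q y ≤ periodEnergy f q z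

lemma IsPeriodicSeq.translate {q p : ℤ} {y : ℤ → ℝ} (hy : IsPeriodicSeq q p y) (k l : ℤ) :
    IsPeriodicSeq q p (translate k l y) := by
  intro i
  have := hy (i - k)
  simp only [FrenkelKontorova.translate]
  rw [show i + q - k = i - k + q by ring, this]
  ring

lemma IsPeriodicSeq.sup {q p : ℤ} {x y : ℤ → ℝ} (hx : IsPeriodicSeq q p x)
    (hy : IsPeriodicSeq q p y) : IsPeriodicSeq q p (x ⊔ y) := by
  intro i
  simp only [Pi.sup_apply, hx i, hy i, max_add_add_right]

lemma IsPeriodicSeq.inf {q p : ℤ} {x y : ℤ → ℝ} (hx : IsPeriodicSeq q p x)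
    (hy : IsPeriodicSeq q p y) : IsPeriodicSeq q p (x ⊓ y) := by
  intro i
  simp only [Pi.inf_apply, hx i, hy i, min_add_add_right]

lemma IsPeriodicSeq.nat_mul {q p : ℤ} {y : ℤ → ℝ} (hy : IsPeriodicSeq q p y) (n : ℕ) :
    IsPeriodicSeq (n * q) (n * p) y := by
  intro i
  induction n with
  | zero => simp
  | succ n ih =>
    have := hy (i + n * q)
    rw [show i + ((n + 1 : ℕ) : ℤ) * q = i + n * q + q by push_cast; ring, this, ih]
    push_cast; ring

namespace IsPotentialFamily

variable {K lam : ℝ} {f : Fin r → ℝ × ℝ → ℝ}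

lemma linkEnergy_period (hf : IsPotentialFamily K lam f) {q p : ℤ} (hq : 0 < q) {y : ℤ → ℝ}
    (hy : IsPeriodicSeq q p y) (a : ℤ) :
    linkEnergy f (Finset.Icc a (a + q - 1)) y = periodEnergy f q y := by
  have hstep : ∀ a : ℤ, linkEnergy f (Finset.Icc (a + 1) (a + 1 + q - 1)) y =
      linkEnergy f (Finset.Icc a (a + q - 1)) y := by
    intro a
    have e1 : Finset.Icc (a + 1) (a + 1 + q - 1) =
        insert (a + q) (Finset.Icc (a + 1) (a + q - 1)) := by
      ext i; simp only [Finset.mem_Icc, Finset.mem_insert]; omega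
    have e2 : Finset.Icc a (a + q - 1) = insert a (Finset.Icc (a + 1) (a + q - 1)) := by
      ext i; simp only [Finset.mem_Icc, Finset.mem_insert]; omega
    unfold linkEnergy
    rw [e1, e2, Finset.sum_insert (by simp), Finset.sum_insert (by simp)]
    congr 1
    refine Finset.sum_congr rfl fun j _ => ?_
    rw [show a + q + disp j = a + disp j + q by ring, hy, hy, hf.apply_add_intCast]
  induction a using Int.induction_on with
  | zero => simp [periodEnergy]
  | succ n ih => rw [hstep, ih]
  | pred n ih =>
    rw [← ih]
    have := hstep (-(n : ℤ) - 1)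
    rw [sub_add_cancel] at this
    exact this.symm

lemma periodEnergy_translate (hf : IsPotentialFamily K lam f) {q p : ℤ} (hq : 0 < q) {y : ℤ → ℝ}
    (hy : IsPeriodicSeq q p y) (k l : ℤ) :
    periodEnergy f q (translate k l y) = periodEnergy f q y := by
  rw [← hf.linkEnergy_period hq hy (0 - k), periodEnergy, hf.linkEnergy_translate]
  congr 2; ring

lemma periodEnergy_nat_mul (hf : IsPotentialFamily K lam f) {q p : ℤ} (hq : 0 < q) {y : ℤ → ℝ}
    (hy : IsPeriodicSeq q p y) (n : ℕ) : periodEnergy f (n * q) y = n * periodEnergy f q y := by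
  induction n with
  | zero => simp [periodEnergy, linkEnergy]
  | succ n ih =>
    have h0 : 0 ≤ (n : ℤ) * q := by positivity
    have e : Finset.Icc 0 (((n + 1 : ℕ) : ℤ) * q - 1) =
        Finset.Icc 0 (n * q - 1) ∪ Finset.Icc (n * q) (n * q + q - 1) := by
      have : ((n + 1 : ℕ) : ℤ) * q = n * q + q := by push_cast; ring
      rw [this]
      ext i; simp only [Finset.mem_Icc, Finset.mem_union]; omega
    have h1 := hf.linkEnergy_period hq hy (n * q)
    unfold periodEnergy at *
    unfold linkEnergy at *
    rw [e, Finset.sum_union, ih, h1]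
    · push_cast; ring
    · rw [Finset.disjoint_left]
      intro i hi hi'
      simp only [Finset.mem_Icc] at hi hi'
      omega

/-- Supremum and infimum arise by exchange on `{x < y}`, whose cut links have ends of opposite weak
sign, so that no positive cost occurs. -/
lemma linkEnergy_sup_add_inf_le (hf : IsPotentialFamily K lam f) (B : Finset ℤ) (x y : ℤ → ℝ) :
    linkEnergy f B (x ⊔ y) + linkEnergy f B (x ⊓ y) ≤ linkEnergy f B x + linkEnergy f B y := by
  have h := hf.linkEnergy_swapOn_add_le (u := fun m => x m - y m) (fun _ => rfl)
    {m | x m < y m} B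
  have e1 : swapOn {m | x m < y m} x y = x ⊔ y := by
    funext i
    by_cases hi : x i < y i
    · rw [swapOn_of_mem hi, Pi.sup_apply, max_eq_right hi.le]
    · rw [swapOn_of_notMem hi, Pi.sup_apply, max_eq_left (not_lt.1 hi)]
  have e2 : swapOn {m | x m < y m} y x = x ⊓ y := by
    funext i
    by_cases hi : x i < y i
    · rw [swapOn_of_mem hi, Pi.inf_apply, min_eq_left hi.le]
    · rw [swapOn_of_notMem hi, Pi.inf_apply, min_eq_right (not_lt.1 hi)]
  have h1 : cutSum r {m | x m < y m} B (posLink fun m => x m - y m) = 0 := by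
    refine Finset.sum_eq_zero fun i _ => Finset.sum_eq_zero fun j _ => ?_
    split_ifs with hc
    · rfl
    · refine max_eq_right ?_
      by_cases hi : x i < y i
      · have hk : ¬ x (i + disp j) < y (i + disp j) := fun hk => hc (iff_of_true hi hk)
        simp only
        nlinarith
      · have hk : x (i + disp j) < y (i + disp j) := by
          by_contra hk
          exact hc (iff_of_false hi hk)
        simp only
        nlinarith
  have h2 : 0 ≤ cutSum r {m | x m < y m} B (negLink fun m => x m - y m) := by
    refine Finset.sum_nonneg fun m _ => Finset.sum_nonneg fun j _ => ?_
    split_ifs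
    · exact le_rfl
    · exact negLink_nonneg _ _ _
  have h3 := mul_nonneg hf.lam_pos.le h2
  rw [e1, e2, h1] at h
  linarith

lemma isPeriodicMinimizer_sup (hf : IsPotentialFamily K lam f) {q p : ℤ} {x y : ℤ → ℝ}
    (hx : IsPeriodicMinimizer f q p x) (hy : IsPeriodicMinimizer f q p y) :
    IsPeriodicMinimizer f q p (x ⊔ y) := by
  refine ⟨hx.1.sup hy.1, fun z hz => ?_⟩
  have h1 := hf.linkEnergy_sup_add_inf_le (Finset.Icc 0 (q - 1)) x y
  have h2 := hx.2 _ (hx.1.inf hy.1)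
  have h3 := hy.2 z hz
  unfold periodEnergy at *
  linarith

lemma isPeriodicMinimizer_translate (hf : IsPotentialFamily K lam f) {q p : ℤ} (hq : 0 < q)
    {x : ℤ → ℝ} (hx : IsPeriodicMinimizer f q p x) (k l : ℤ) :
    IsPeriodicMinimizer f q p (translate k l x) := by
  refine ⟨hx.1.translate k l, fun z hz => ?_⟩
  rw [hf.periodEnergy_translate hq hx.1]
  exact hx.2 z hz

/-- Among the minimizers of the `n`-fold period there are sequences of the simple period. -/
lemma exists_isPeriodicMinimizer_simple_period (hf : IsPotentialFamily K lam f) {k l : ℤ}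
    (hk : 0 < k) {n : ℕ} (hn : 0 < n) {w : ℤ → ℝ}
    (hw : IsPeriodicMinimizer f (n * k) (n * l) w) :
    ∃ M, IsPeriodicMinimizer f (n * k) (n * l) M ∧ IsPeriodicSeq k l M := by
  have hq : 0 < (n : ℤ) * k := by positivity
  set g : ℕ → ℤ → ℝ := fun j => translate (j * k) (j * l) w with hg
  have hper : ∀ j, g (j + n) = g j := by
    intro j
    funext i
    have := hw.1 (i - (j + n : ℕ) * k)
    simp only [hg, translate]
    rw [show i - ((j + n : ℕ) : ℤ) * k + n * k = i - j * k by push_cast; ring] at this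
    rw [this]
    push_cast; ring
  have hsucc : ∀ j i, g (j + 1) i = g j (i - k) + l := by
    intro j i
    simp only [hg, translate]
    rw [show i - ((j + 1 : ℕ) : ℤ) * k = i - k - j * k by push_cast; ring]
    push_cast; ring
  -- The translates by `(k, l)` repeat after `n` steps, so they are permuted by one more
  -- translation, and their supremum is invariant under it.
  refine ⟨partialSups g n, ?_, ?_⟩
  · have : ∀ m, IsPeriodicMinimizer f (n * k) (n * l) (partialSups g m) := by
      intro m
      induction m with
      | zero => rw [partialSups_zero]; exact hf.isPeriodicMinimizer_translate hq hw _ _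
      | succ m ih =>
        rw [partialSups_add_one]
        exact hf.isPeriodicMinimizer_sup ih (hf.isPeriodicMinimizer_translate hq hw _ _)
    exact this n
  · have hle : ∀ j ≤ n, g j ≤ partialSups g n := fun j hj => le_partialSups_of_le g hj
    have h1 : partialSups g n ≤ fun i => partialSups g n (i + k) - l := by
      refine partialSups_le _ _ _ fun j hj i => ?_
      have e := hsucc j (i + k)
      rw [add_sub_cancel_right] at e
      have h : g (j + 1) ≤ partialSups g n := by
        rcases hj.lt_or_eq with h | h
        · exact hle _ h
        · rw [h, add_comm, hper 1]; exact hle 1 hn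
      have := h (i + k)
      simp only
      linarith
    have h2 : partialSups g n ≤ fun i => partialSups g n (i - k) + l := by
      have h3 : ∀ j ≤ n, g (j + 1) ≤ fun i => partialSups g n (i - k) + l := by
        intro j hj i
        rw [hsucc]
        have := hle j hj (i - k)
        simp only
        linarith
      refine partialSups_le _ _ _ fun j hj => ?_
      rcases Nat.eq_zero_or_pos j with h | h
      · have h4 := h3 (n - 1) (Nat.sub_le n 1)
        rw [Nat.sub_add_cancel hn] at h4
        rwa [h, ← hper 0, zero_add]
      · rw [← Nat.succ_pred_eq_of_pos h]
        exact h3 _ ((Nat.pred_le j).trans hj)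
    intro i
    have a1 := h1 i
    have a2 := h2 (i + k)
    simp only [add_sub_cancel_right] at a1 a2
    linarith

/-- The minimum for the `n`-fold period is attained at a sequence of simple period, whose energy is
`n` times that of one period; `y` does at least as well. -/
lemma isPeriodicMinimizer_nat_mul (hf : IsPotentialFamily K lam f) {k l : ℤ} (hk : 0 < k)
    (hex : ∀ q p : ℤ, 0 < q → ∃ w, IsPeriodicMinimizer f q p w)
    {y : ℤ → ℝ} (hy : IsPeriodicMinimizer f k l y) {n : ℕ} (hn : 0 < n) :
    IsPeriodicMinimizer f (n * k) (n * l) y := by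
  refine ⟨hy.1.nat_mul n, fun z hz => ?_⟩
  obtain ⟨w, hw⟩ := hex (n * k) (n * l) (by positivity)
  obtain ⟨M, hM, hM'⟩ := hf.exists_isPeriodicMinimizer_simple_period hk hn hw
  have h1 := hM.2 z hz
  have h2 := hy.2 M hM'
  rw [hf.periodEnergy_nat_mul hk hM'] at h1
  rw [hf.periodEnergy_nat_mul hk hy.1]
  have : (n : ℝ) * periodEnergy f k y ≤ n * periodEnergy f k M := by gcongr
  linarith

lemma isMinimizing_of_isPeriodicMinimizer (hf : IsPotentialFamily K lam f) {k l : ℤ} (hk : 0 < k)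
    (hex : ∀ q p : ℤ, 0 < q → ∃ w, IsPeriodicMinimizer f q p w)
    {y : ℤ → ℝ} (hy : IsPeriodicMinimizer f k l y) : IsMinimizing f y := by
  intro a b hab z hz
  have hzy : ∀ i, i < a ∨ b < i → z i = y i := fun i hi => hz i fun h => by
    have := h.1
    have := h.2
    omega
  obtain ⟨n, hn⟩ : ∃ n : ℕ, (n : ℤ) = b - a + r + 1 := ⟨(b - a + r + 1).toNat, by omega⟩
  have hmin := hf.isPeriodicMinimizer_nat_mul hk hex hy (n := n) (by omega)
  set q : ℤ := n * k with hq
  have hqn : b - a + r + 1 ≤ q := by nlinarith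
  have hq0 : 0 < q := by omega
  -- The perturbation `z - y` is repeated with period `q`, which exceeds the window, so comparing
  -- `Z` with `y` over one period is the original comparison.
  set Z : ℤ → ℝ := fun i => y i + (z (a - r + (i - (a - r)) % q) - y (a - r + (i - (a - r)) % q))
    with hZ
  have hZper : IsPeriodicSeq q (n * l) Z := by
    intro i
    have e : (i + q - (a - r)) % q = (i - (a - r)) % q := by
      rw [show i + q - (a - r) = i - (a - r) + q by ring, Int.add_emod_right]
    simp only [hZ, e, hmin.1 i]
    ring
  have hZz : ∀ i, a - r ≤ i → i ≤ a - 1 + q → Z i = z i := by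
    intro i h1 h2
    simp only [hZ]
    rcases lt_or_ge i (a - r + q) with h | h
    · rw [Int.emod_eq_of_lt (by omega) (by omega), add_sub_cancel]
      ring
    · have e : (i - (a - r)) % q = i - q - (a - r) := by
        rw [← Int.sub_emod_right, Int.emod_eq_of_lt (by omega) (by omega)]
        ring
      rw [e, add_sub_cancel, hzy (i - q) (by omega), hzy i (by omega)]
      ring
  have hle := hmin.2 Z hZper
  rw [← hf.linkEnergy_period hq0 hmin.1 (a - r), ← hf.linkEnergy_period hq0 hZper (a - r)] at hle
  have hsub : Finset.Icc (a - r) b ⊆ Finset.Icc (a - r) (a - r + q - 1) :=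
    Finset.Icc_subset_Icc le_rfl (by omega)
  have hdiff : linkEnergy f (Finset.Icc (a - r) b) z - linkEnergy f (Finset.Icc (a - r) b) y =
      linkEnergy f (Finset.Icc (a - r) (a - r + q - 1)) Z -
        linkEnergy f (Finset.Icc (a - r) (a - r + q - 1)) y := by
    unfold linkEnergy
    rw [← Finset.sum_sub_distrib, ← Finset.sum_sub_distrib, ← Finset.sum_subset hsub]
    · refine Finset.sum_congr rfl fun i hi => ?_
      rw [Finset.mem_Icc] at hi
      congr 1
      refine Finset.sum_congr rfl fun j _ => ?_
      have h1 := one_le_disp j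
      have h2 := disp_le j
      rw [hZz i (by omega) (by omega), hZz (i + disp j) (by omega) (by omega)]
    · intro i hi hi'
      rw [Finset.mem_Icc] at hi hi'
      rw [sub_eq_zero]
      refine Finset.sum_congr rfl fun j _ => ?_
      have h1 := one_le_disp j
      have h2 := disp_le j
      rw [hZz i (by omega) (by omega), hZz (i + disp j) (by omega) (by omega), hzy i (by omega),
        hzy (i + disp j) (by omega)]
  linarith

lemma exists_coercive_bound (hf : IsPotentialFamily K lam f) (j : Fin r) (c : ℝ) :
    ∃ R, 0 ≤ R ∧ ∀ ν μ : ℝ, f j (ν, μ) ≤ c → |ν - μ| ≤ R := by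
  have h := (hf.coercive j).eventually_gt_atTop c
  rw [eventually_comap, eventually_atTop] at h
  obtain ⟨R, hR⟩ := h
  refine ⟨max R 0, le_max_right _ _, fun ν μ hle => ?_⟩
  by_contra! hc
  exact absurd hle (not_le.2 (hR _ ((le_max_left _ _).trans hc.le) (ν, μ) rfl))

/-- Outside a strip around the diagonal the potential is positive, and integer translation along the
diagonal reduces the strip to a compact box. -/
lemma exists_lower_bound (hf : IsPotentialFamily K lam f) (j : Fin r) :
    ∃ B, ∀ p : ℝ × ℝ, B ≤ f j p := by
  obtain ⟨R, hR0, hR⟩ := hf.exists_coercive_bound j 0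
  obtain ⟨m, hm⟩ := ((isCompact_Icc (a := (0 : ℝ)) (b := 1)).prod
    (isCompact_Icc (a := -R) (b := 1 + R))).bddBelow_image
    (hf.pair j).contDiff.continuous.continuousOn
  refine ⟨min m 0, fun p => ?_⟩
  rcases le_or_gt 0 (f j p) with h | h
  · exact (min_le_right _ _).trans h
  · have h1 := abs_le.1 (hR p.1 p.2 h.le)
    have e := hf.apply_add_intCast j (-⌊p.1⌋) p.1 p.2
    refine (min_le_left _ _).trans ?_
    rw [show p = (p.1, p.2) from rfl, ← e]
    refine hm ⟨_, ⟨⟨?_, ?_⟩, ?_, ?_⟩, rfl⟩ <;> push_cast <;>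
      linarith [Int.floor_le p.1, Int.lt_floor_add_one p.1]

lemma exists_step_bound (hf : IsPotentialFamily K lam f) {q : ℤ} (hq : 0 < q) (p : ℤ) (c : ℝ) :
    ∃ R, 0 ≤ R ∧ ∀ y, IsPeriodicSeq q p y → periodEnergy f q y ≤ c →
      ∀ i, |y i - y (i + 1)| ≤ R := by
  choose B hB using hf.exists_lower_bound
  obtain ⟨j₀, hj₀⟩ := exists_disp_eq (r := r) (m := 1) le_rfl (by exact_mod_cast hf.one_le_range)
  -- Bounding all other terms of a period from below leaves this upper bound for a single
  -- nearest-neighbour term.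
  obtain ⟨R, hR0, hR⟩ := hf.exists_coercive_bound j₀ (c - q * ∑ j, B j + B j₀)
  refine ⟨R, hR0, fun y hy hc i => hR _ _ ?_⟩
  rw [← hf.linkEnergy_period hq hy i] at hc
  have h1 : f j₀ (y i, y (i + 1)) - B j₀ ≤ ∑ j, (f j (y i, y (i + disp j)) - B j) := by
    have := Finset.single_le_sum (f := fun j => f j (y i, y (i + disp j)) - B j)
      (fun j _ => sub_nonneg.2 (hB j _)) (Finset.mem_univ j₀)
    simpa only [hj₀] using this
  have h2 := Finset.single_le_sum (s := Finset.Icc i (i + q - 1))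
    (f := fun i => ∑ j, (f j (y i, y (i + disp j)) - B j))
    (fun i _ => Finset.sum_nonneg fun j _ => sub_nonneg.2 (hB j _))
    (Finset.mem_Icc.2 ⟨le_rfl, by omega⟩ : i ∈ _)
  simp only [Finset.sum_sub_distrib] at h1 h2
  rw [Finset.sum_const, Int.card_Icc, nsmul_eq_mul] at h2
  have e : (((i + q - 1 + 1 - i).toNat : ℕ) : ℝ) = q := by
    have : ((i + q - 1 + 1 - i).toNat : ℤ) = q := by omega
    exact_mod_cast this
  rw [e] at h2
  unfold linkEnergy at hc
  linarith

lemma exists_isPeriodicMinimizer (hf : IsPotentialFamily K lam f) {q : ℤ} (p : ℤ) (hq : 0 < q) :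
    ∃ w, IsPeriodicMinimizer f q p w := by
  have hq' : (0 : ℝ) < q := by exact_mod_cast hq
  set y₀ : ℤ → ℝ := fun i => p * i / q with hy₀
  have hy₀per : IsPeriodicSeq q p y₀ := by
    intro i
    simp only [hy₀]
    push_cast
    field_simp
  obtain ⟨R, hR0, hR⟩ := hf.exists_step_bound hq p (periodEnergy f q y₀)
  set T : Set (ℤ → ℝ) := Set.univ.pi 
    (fun i : ℤ => Set.Icc (-(1 + |(i : ℝ)| * R)) (1 + |(i : ℝ)| * R)) ∩
      {y | IsPeriodicSeq q p y} with hT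
  have hclosed : IsClosed {y : ℤ → ℝ | IsPeriodicSeq q p y} := by
    simp only [IsPeriodicSeq, Set.ofPred_forall]
    exact isClosed_iInter fun i => isClosed_eq (by fun_prop) (by fun_prop)
  have hcomp : IsCompact T := (isCompact_univ_pi fun i => isCompact_Icc).inter_right hclosed
  have hcont : Continuous (periodEnergy f q) := by
    unfold periodEnergy linkEnergy
    refine continuous_finsetSum _ fun i _ => continuous_finsetSum _ fun j _ => ?_
    exact (hf.pair j).contDiff.continuous.comp
      ((continuous_apply i).prodMk (continuous_apply (i + disp j)))
  have hmem : ∀ y, IsPeriodicSeq q p y → periodEnergy f q y ≤ periodEnergy f q y₀ → 0 ≤ y 0 →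
      y 0 ≤ 1 → y ∈ T := by
    intro y hy hc h0 h1
    have hs := hR y hy hc
    have hb : ∀ i : ℤ, |y i - y 0| ≤ |(i : ℝ)| * R := by
      intro i
      induction i using Int.induction_on with
      | zero => simp
      | succ n ih =>
        have h := hs n
        have e : |(((n : ℤ) + 1 : ℤ) : ℝ)| = |((n : ℤ) : ℝ)| + 1 := by
          push_cast
          rw [abs_of_nonneg (by positivity), abs_of_nonneg (by positivity)]
        rw [e]
        rw [abs_sub_comm] at h
        have := abs_sub_le (y (n + 1)) (y n) (y 0)
        linarith
      | pred n ih =>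
        have h := hs (-(n : ℤ) - 1)
        rw [sub_add_cancel] at h
        have e : |((-(n : ℤ) - 1 : ℤ) : ℝ)| = |((-(n : ℤ) : ℤ) : ℝ)| + 1 := by
          push_cast
          rw [abs_neg, abs_of_nonneg (by positivity : (0 : ℝ) ≤ n),
            abs_of_nonpos (by linarith [(by positivity : (0 : ℝ) ≤ n)])]
          ring
        rw [e]
        have := abs_sub_le (y (-(n : ℤ) - 1)) (y (-(n : ℤ))) (y 0)
        linarith
    refine ⟨fun i _ => ?_, hy⟩
    have := abs_le.1 (hb i)
    exact ⟨by linarith, by linarith⟩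
  have hy₀T : y₀ ∈ T := hmem y₀ hy₀per le_rfl (by simp [hy₀]) (by simp [hy₀])
  obtain ⟨w, hwT, hw⟩ := hcomp.exists_isMinOn ⟨y₀, hy₀T⟩ hcont.continuousOn
  refine ⟨w, hwT.2, fun z hz => ?_⟩
  rcases le_total (periodEnergy f q z) (periodEnergy f q y₀) with h | h
  · have e := hf.periodEnergy_translate hq hz 0 (-⌊z 0⌋)
    rw [← e]
    refine hw (hmem _ (hz.translate _ _) (e.trans_le h) ?_ ?_) <;>
      simp only [translate, sub_zero] <;> push_cast <;>
      linarith [Int.floor_le (z 0), Int.lt_floor_add_one (z 0)]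
  · exact (hw hy₀T).trans h

/-- For every `k > 0` and `l` there is a minimizer with `y_{i + k} = y_i + l`. -/
lemma exists_periodic_isMinimizing (hf : IsPotentialFamily K lam f) {k : ℤ} (l : ℤ)
    (hk : 0 < k) : ∃ y, IsMinimizing f y ∧ IsPeriodicSeq k l y := by
  obtain ⟨y, hy⟩ := hf.exists_isPeriodicMinimizer l hk
  exact ⟨y, hf.isMinimizing_of_isPeriodicMinimizer hk
    (fun q p hq => hf.exists_isPeriodicMinimizer p hq) hy, hy.1⟩

/-! ### Ordering of a slowly growing minimizer and its translates. -/

/-- A slowly growing minimizer is ordered with respect to its translates. -/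
lemma translate_le_or_le (hf : IsPotentialFamily K lam f) {x : ℤ → ℝ} (hx : IsMinimizing f x)
    {a b : ℝ} (ha : 0 ≤ a) (hb : 0 ≤ b) (hexp : ∀ i : ℤ, |x i| ≤ a * (2 : ℝ) ^ (b * |(i : ℝ)|))
    {N : ℕ} (hN : 4 * K ^ 2 * r ≤ N * lam ^ 2) (hNb : 6 * r * N * b < 1) {k : ℤ} (hk : 0 < k)
    (l : ℤ) : translate k l x ≤ x ∨ x ≤ translate k l x := by
  have hy := hf.isMinimizing_translate hx k l
  obtain ⟨w, hw, hwper⟩ := hf.exists_periodic_isMinimizing l hk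
  have hwk : ∀ i, w (i - k) = w i - l := by
    intro i
    have := hwper (i - k)
    rw [sub_add_cancel] at this
    linarith
  have hbound : ∀ i : ℤ, |x i - translate k l x i| ≤
      (a + a * 2 ^ (b * |(k : ℝ)|) + |(l : ℝ)|) * (2 : ℝ) ^ (b * |(i : ℝ)|) := by
    intro i
    have h1 := hexp i
    have h2 := hexp (i - k)
    have h3 : a * (2 : ℝ) ^ (b * |((i - k : ℤ) : ℝ)|) ≤
        a * 2 ^ (b * |(k : ℝ)|) * (2 : ℝ) ^ (b * |(i : ℝ)|) := by
      rw [mul_assoc, ← Real.rpow_add (by norm_num), ← mul_add]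
      gcongr
      · norm_num
      · push_cast
        rw [add_comm]
        exact abs_sub _ _
    have h4 : (1 : ℝ) ≤ 2 ^ (b * |(i : ℝ)|) :=
      Real.one_le_rpow (by norm_num) (by positivity)
    have h5 : |(l : ℝ)| ≤ |(l : ℝ)| * 2 ^ (b * |(i : ℝ)|) :=
      le_mul_of_one_le_right (abs_nonneg _) h4
    have h6 : |x i - translate k l x i| ≤ |x i| + (|x (i - k)| + |(l : ℝ)|) :=
      (abs_sub _ _).trans (add_le_add le_rfl (abs_add_le _ _))
    calc _ ≤ _ := h6
      _ ≤ _ := add_le_add h1 (add_le_add (h2.trans h3) h5)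
      _ = _ := by ring
  rcases hf.ordered_or_crossing hx hy (u := fun i => x i - translate k l x i) (fun _ => rfl)
    (by positivity) hb hbound hN hNb with h | ⟨L, M, ⟨hL, hM⟩ | ⟨hL, hM⟩⟩
  · exact h.symm
  · refine (hf.ordered_of_crossing hx hy (u := fun i => x i - translate k l x i)
      (w := fun i => x i - w i) (fun _ => rfl) hk (fun i => ?_) (fun m => ?_) hL hM).symm
    · simp only [translate, hwk]; ring
    · refine ⟨translate 0 m w, x, hf.isMinimizing_translate hw 0 m, hx, fun i => ?_⟩
      simp only [translate, sub_zero]; ring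
  -- The reversed crossing is reduced to the previous one by exchanging roles, with `w - x` in place
  -- of `x - w`.
  · refine hf.ordered_of_crossing hy hx (u := fun i => translate k l x i - x i)
      (w := fun i => w i - x i) (fun _ => rfl) hk (fun i => ?_) (fun m => ?_)
      (L := L) (M := M) (fun i hi => ?_) (fun i hi => ?_)
    · simp only [translate, hwk]; ring
    · refine ⟨x, translate 0 (-m) w, hx, hf.isMinimizing_translate hw 0 (-m), fun i => ?_⟩
      simp only [translate, sub_zero]; push_cast; ring
    · linarith [hL i hi]
    · linarith [hM i hi]

lemma isBirkhoff_of_slow_growth (hf : IsPotentialFamily K lam f) {x : ℤ → ℝ}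
    (hx : IsMinimizing f x) {a b : ℝ} (ha : 0 ≤ a) (hb : 0 ≤ b)
    (hexp : ∀ i : ℤ, |x i| ≤ a * (2 : ℝ) ^ (b * |(i : ℝ)|)) {N : ℕ}
    (hN : 4 * K ^ 2 * r ≤ N * lam ^ 2) (hNb : 6 * r * N * b < 1) : IsBirkhoff x := by
  intro k l
  rcases lt_trichotomy k 0 with hk | hk | hk
  -- For negative `k`, compare with the inverse translate and shift the index back.
  · have hs : ∀ i, translate (-k) (-l) x (i - k) = x i - l := fun i => by
      simp [translate, sub_eq_add_neg]
    rcases hf.translate_le_or_le hx ha hb hexp hN hNb (neg_pos.2 hk) (-l) with h | h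
    · right
      intro i
      have h1 := h (i - k)
      rw [hs] at h1
      simp only [translate]
      linarith
    · left
      intro i
      have h1 := h (i - k)
      rw [hs] at h1
      simp only [translate]
      linarith
  · subst hk
    rcases le_total (l : ℝ) 0 with hl | hl
    · left
      intro i
      simp only [translate, sub_zero]
      linarith
    · right
      intro i
      simp only [translate, sub_zero]
      linarith
  · exact hf.translate_le_or_le hx ha hb hexp hN hNb hk l

end IsPotentialFamily

lemma IsLocalEnergy.exists_isPotentialFamily {K lam : ℝ} {S : (Fin (r + 1) → ℝ) → ℝ}
    (hS : IsLocalEnergy r K lam S) : ∃ f : Fin r → ℝ × ℝ → ℝ,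
      (∀ ξ, S ξ = ∑ j : Fin r, f j (ξ 0, ξ j.succ)) ∧ IsPotentialFamily K lam f := by
  obtain ⟨f, hSf, hf⟩ := hS.exists_potentials
  exact ⟨f, hSf, hS.one_le_range, hS.K_pos, hS.lam_pos,
    fun j => ⟨(hf j).1, (hf j).2.2.1, (hf j).2.2.2.2⟩, fun j => (hf j).2.1,
    fun j => (hf j).2.2.2.1⟩

end FrenkelKontorova

theorem mainTheorem5 (r : ℕ) (K lam : ℝ) (S : (Fin (r + 1) → ℝ) → ℝ)
    (hS : FrenkelKontorova.IsLocalEnergy r K lam S)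
    (x : ℤ → ℝ) (hx : FrenkelKontorova.IsGlobalMinimizer S x)
    (a b : ℝ) (ha : 0 < a) (hb : 0 < b)
    (hbd : b < 1 / (2 * (FrenkelKontorova.growthConstant r K lam : ℝ)))
    (hgrowth : ∀ i : ℤ, |x i| ≤ a * (2 : ℝ) ^ (b * |(i : ℝ)|)) :
    FrenkelKontorova.IsGlobalMinimizer S x ∧ FrenkelKontorova.IsBirkhoff x := by
  refine ⟨hx, ?_⟩
  obtain ⟨f, hSf, hf⟩ := hS.exists_isPotentialFamily
  have hr : (1 : ℝ) ≤ r := by exact_mod_cast hf.one_le_range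
  have hl := hf.lam_pos
  have hK := hf.K_pos
  set N : ℕ := ⌈24 * K ^ 2 * (2 * r + 1) * r ^ 2 / lam ^ 2⌉₊ with hN
  -- The argument needs only `N ≥ 4 * K ^ 2 * r / lam ^ 2` and `6 * r * N * b < 1`; the given `d`
  -- satisfies both with room to spare.
  refine hf.isBirkhoff_of_slow_growth
    ((FrenkelKontorova.isGlobalMinimizer_iff_isMinimizing hSf x).1 hx) ha.le hb.le hgrowth
    (N := N) ?_ ?_
  · have h1 : 24 * K ^ 2 * (2 * r + 1) * r ^ 2 / lam ^ 2 ≤ N := Nat.le_ceil _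
    rw [div_le_iff₀ (by positivity)] at h1
    refine le_trans ?_ h1
    have h2 : (1 : ℝ) ≤ (2 * r + 1) * r := by nlinarith
    have h3 : 0 ≤ K ^ 2 * r := by positivity
    nlinarith [mul_le_mul_of_nonneg_left h2 h3]
  · have hd : (FrenkelKontorova.growthConstant r K lam : ℝ) = 6 * r * N + 4 * r := by
      unfold FrenkelKontorova.growthConstant
      push_cast
      rfl
    rw [hd, lt_div_iff₀ (by positivity)] at hbd
    have h1 : 0 ≤ 6 * (r : ℝ) * N * b := by positivity
    have h2 : 0 ≤ (r : ℝ) * b := by positivity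
    nlinarith
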